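/- Let $G$ be a connected and simply connected real Lie group of dimension $n$, endowed with a left-invariant Riemannian metric $h$, and let $\langle\cdot,\cdot\rangle$ be the induced scalar product on its Lie algebra $\mathfrak g$ (the left-invariant vector fields, identified with $T_eG$). Suppose that $(G,h)$ is cyclic, i.e. $$\langle [X,Y],Z\rangle+\langle [Y,Z],X\rangle+\langle [Z,X],Y\rangle=0\qquad (X,Y,Z\in\mathfrak g),$$ that $G$ is solvable (i.e. $\mathfrak g$ is a solvable Lie algebra), and that $G$ is not abelian. For integers $p,q\ge 1$ and a real $q\times p$ matrix $\Omega$ with columns $\Omega_1,\dots,\Omega_p\in\mathbb R^q$, let $G(q,p,\Omega)$ be the Lie group with underlying manifold $\mathbb R^q\times\mathbb R^p$ and product $$(s,t)\cdot(s',t')=\bigl(s+s',\;t+(e^{\langle s,\Omega_1\rangle_0}t_1',\dots,e^{\langle s,\Omega_p\rangle_0}t_p')\bigr),$$ where $\langle\cdot,\cdot\rangle_0$ is the Euclidean inner product, and let $h_0=\sum_{i=1}^q ds_i^2+\sum_{i=1}^p e^{-2\langle s,\Omega_i\rangle_0}dt_i^2$. Then: 1. There are integers $q,p\ge1$ and $r\ge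 0$ with $p+q+r=n$, and a real $q\times p$ matrix $\Omega$ whose transpose $\Omega^t$ has rank $q$, such that $(G,h)$ is isomorphic, both as a Lie group and as a Riemannian manifold, to $(G(q,p,\Omega)\times\mathbb R^r,\;h_0\oplus\langle\cdot,\cdot\rangle_0)$: there is a group isomorphism between them which is a diffeomorphism and an isometry. 2. The derived algebra $[\mathfrak g,\mathfrak g]$ is abelian. For every $u\in[\mathfrak g,\mathfrak g]^\perp$ the operator $\mathrm{ad}_u$ is symmetric with respect to $\langle\cdot,\cdot\rangle$; the operators $\mathrm{ad}_u$, $u\in[\mathfrak g,\mathfrak g]^\perp$, commute with each other; and there is an orthonormal basis of $\mathfrak g$ consisting of common eigenvectors of all of them. -/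

import Mathlib

open scoped Manifold ContDiff Topology
open Bundle

noncomputable section

namespace CyclicLie

/-- A smooth Riemannian metric on the manifold `M`. -/
abbrev RiemannianMetricOn {E H : Type*} [NormedAddCommGroup E] [NormedSpace ℝ E] [TopologicalSpace H]
   (I : ModelWithCorners ℝ E H) (M : Type*) [TopologicalSpace M] [ChartedSpace H M] [IsManifold I ∞ M] :=
  ContMDiffRiemannianMetric I ∞ E (fun x : M => TangentSpace I x)

section Metrics

variable {E H E' H' : Type*} [NormedAddCommGroup E] [NormedSpace ℝ E] [TopologicalSpace H]
  {I : ModelWithCorners ℝ E H} {M : Type*} [TopologicalSpace M] [ChartedSpace H M] [IsManifold I ∞ M]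
  [NormedAddCommGroup E'] [NormedSpace ℝ E'] [TopologicalSpace H']
  {J : ModelWithCorners ℝ E' H'} {N : Type*} [TopologicalSpace N] [ChartedSpace H' N] [IsManifold J ∞ N]

/-! ### Riemannian products -/

theorem tangentCoordChange_prod (z₀ z : M × N) (hz : z ∈ (extChartAt (I.prod J) z₀).source) :
   tangentCoordChange (I.prod J) z₀ z z =
    (tangentCoordChange I z₀.1 z.1 z.1).prodMap (tangentCoordChange J z₀.2 z.2 z.2) := by
  have hI : IsManifold I 1 M := inferInstance
  have hJ : IsManifold J 1 N := inferInstance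
  have h0 := hz
  rw [extChartAt_prod, PartialEquiv.prod_source] at h0
  have a1 := hasFDerivWithinAt_tangentCoordChange (I := I) (x := z₀.1) (y := z.1) (z := z.1)
    ⟨h0.1, mem_extChartAt_source _⟩
  have a2 := hasFDerivWithinAt_tangentCoordChange (I := J) (x := z₀.2) (y := z.2) (z := z.2)
    ⟨h0.2, mem_extChartAt_source _⟩
  have a3 := hasFDerivWithinAt_tangentCoordChange (I := I.prod J) (x := z₀) (y := z) (z := z)
    ⟨hz, mem_extChartAt_source _⟩
  have a4 : HasFDerivWithinAt (Prod.map (extChartAt I z.1 ∘ (extChartAt I z₀.1).symm)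
      (extChartAt J z.2 ∘ (extChartAt J z₀.2).symm))
      ((tangentCoordChange I z₀.1 z.1 z.1).prodMap (tangentCoordChange J z₀.2 z.2 z.2))
      (Set.range (I.prod J)) (extChartAt (I.prod J) z₀ z) := by
    have e : extChartAt (I.prod J) z₀ z = (extChartAt I z₀.1 z.1, extChartAt J z₀.2 z.2) := by
      rw [extChartAt_prod]; rfl
    rw [e]
    apply HasFDerivWithinAt.prodMap
    · exact a1.mono (by rintro _ ⟨_, ⟨y, rfl⟩, rfl⟩; exact ⟨y.1, rfl⟩)
    · exact a2.mono (by rintro _ ⟨_, ⟨y, rfl⟩, rfl⟩; exact ⟨y.2, rfl⟩)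
  have e2 : (extChartAt (I.prod J) z ∘ (extChartAt (I.prod J) z₀).symm) =
     Prod.map (extChartAt I z.1 ∘ (extChartAt I z₀.1).symm)
      (extChartAt J z.2 ∘ (extChartAt J z₀.2).symm) := by
    rw [extChartAt_prod, extChartAt_prod]; rfl
  rw [e2] at a3
  refine UniqueDiffWithinAt.eq ?_ a3 a4
  exact (I.prod J).uniqueDiffOn _ ⟨_, rfl⟩

/-- The orthogonal sum of two bilinear forms. -/
def prodForm (a : E →L[ℝ] E →L[ℝ] ℝ) (b : E' →L[ℝ] E' →L[ℝ] ℝ) :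
    (E × E') →L[ℝ] (E × E') →L[ℝ] ℝ :=
  a.bilinearComp (.fst ℝ E E') (.fst ℝ E E') + b.bilinearComp (.snd ℝ E E') (.snd ℝ E E')

theorem prodForm_apply (a : E →L[ℝ] E →L[ℝ] ℝ) (b : E' →L[ℝ] E' →L[ℝ] ℝ) (v w : E × E') :
  prodForm a b v w = a v.1 w.1 + b v.2 w.2 := rfl


/-- The orthogonal sum of bilinear forms on the tangent spaces of two manifolds. -/
def tangentProdForm (z : M × N) (a : TangentSpace I z.1 →L[ℝ] TangentSpace I z.1 →L[ℝ] ℝ)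
    (b : TangentSpace J z.2 →L[ℝ] TangentSpace J z.2 →L[ℝ] ℝ) :
    TangentSpace (I.prod J) z →L[ℝ] TangentSpace (I.prod J) z →L[ℝ] ℝ :=
  prodForm (E := E) (E' := E') a b

/-- Coordinate expression, in the preferred chart at `x₀`, of a bilinear form on `T_x M`. -/
def coordForm (x₀ x : M) (a : TangentSpace I x →L[ℝ] TangentSpace I x →L[ℝ] ℝ) : E →L[ℝ] E →L[ℝ] ℝ :=
  ContinuousLinearMap.inCoordinates E (TangentSpace I) (E →L[ℝ] ℝ)
    (fun y : M => TangentSpace I y →L[ℝ] ℝ) x₀ x x₀ x a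

theorem coordForm_apply (x₀ x : M) (hx : x ∈ (extChartAt I x₀).source)
    (a : TangentSpace I x →L[ℝ] TangentSpace I x →L[ℝ] ℝ) (v w : E) :
    coordForm x₀ x a v w =
      a (tangentCoordChange I x₀ x x v) (tangentCoordChange I x₀ x x w) := by
  have hx' : x ∈ (chartAt H x₀).source := by simpa using hx
  have hb : x ∈ (trivializationAt E (TangentSpace I) x₀).baseSet := by simpa using hx'
  have key := inCoordinates_apply_eq₂ (F₃ := ℝ) (E₃ := Bundle.Trivial M ℝ) (ϕ := a) (v := v) (w := w) hb hb (Set.mem_univ _)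
  have e := TangentBundle.symmL_trivializationAt_eq_core (I := I) hx'
  refine key.trans ?_
  have e1 : ∀ u : E, (trivializationAt E (TangentSpace I) x₀).symm x u = tangentCoordChange I x₀ x x u :=
    fun u => (Trivialization.symmL_apply (R := ℝ) _ hb u).symm.trans (DFunLike.congr_fun e u)
  rw [e1 v, e1 w]
  simp only [Trivial.fiberBundle_trivializationAt', Trivial.linearMapAt_trivialization,
        LinearMap.id_coe, id_eq]

theorem contMDiffAt_form_iff (s : ∀ x : M, TangentSpace I x →L[ℝ] TangentSpace I x →L[ℝ] ℝ) (x₀ : M) :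
    ContMDiffAt I (I.prod 𝓘(ℝ, E →L[ℝ] E →L[ℝ] ℝ)) ∞
      (fun b ↦ TotalSpace.mk' (E →L[ℝ] E →L[ℝ] ℝ) b (s b)) x₀ ↔
    ContMDiffAt I 𝓘(ℝ, E →L[ℝ] E →L[ℝ] ℝ) ∞ (fun x => coordForm x₀ x (s x)) x₀ := by
  rw [contMDiffAt_section]
  rfl

theorem isVonNBounded_prodForm (a : E →L[ℝ] E →L[ℝ] ℝ) (b : E' →L[ℝ] E' →L[ℝ] ℝ)
    (pa : ∀ v, 0 ≤ a v v) (pb : ∀ v, 0 ≤ b v v)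
    (ha : Bornology.IsVonNBounded ℝ {v | a v v < 1}) (hb : Bornology.IsVonNBounded ℝ {v | b v v < 1}) :
    Bornology.IsVonNBounded ℝ {v | prodForm a b v v < 1} := by
  rw [NormedSpace.isVonNBounded_iff] at *
  refine (ha.prod hb).subset fun v hv => ?_
  have : a v.1 v.1 + b v.2 v.2 < 1 := hv
  have h1 := pa v.1
  have h2 := pb v.2
  exact ⟨show a v.1 v.1 < 1 by linarith, show b v.2 v.2 < 1 by linarith⟩

theorem metric_nonneg (g : RiemannianMetricOn I M) (x : M) (v : TangentSpace I x) : 0 ≤ g.inner x v v := by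
  rcases eq_or_ne v 0 with rfl | hv
  · simp
  · exact (g.pos x v hv).le

/-- The product metric `g ⊕ h` on `M × N`. -/
def prodMetric (g : RiemannianMetricOn I M) (h : RiemannianMetricOn J N) : RiemannianMetricOn (I.prod J) (M × N) where
  inner z := tangentProdForm z (g.inner z.1) (h.inner z.2)
  symm z v w := congrArg₂ (· + ·) (g.symm z.1 v.1 w.1) (h.symm z.2 v.2 w.2)
  pos z v hv := by
    change 0 < g.inner z.1 v.1 v.1 + h.inner z.2 v.2 v.2
    have h1 := metric_nonneg g z.1 v.1
    have h2 := metric_nonneg h z.2 v.2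
    by_cases e1 : v.1 = 0
    · have e2 : v.2 ≠ 0 := fun e2 => hv (Prod.ext e1 e2)
      exact add_pos_of_nonneg_of_pos h1 (h.pos z.2 v.2 e2)
    · exact add_pos_of_pos_of_nonneg (g.pos z.1 v.1 e1) h2
  isVonNBounded z := isVonNBounded_prodForm (E := E) (E' := E') _ _ (metric_nonneg g z.1) (metric_nonneg h z.2)
    (g.isVonNBounded z.1) (h.isVonNBounded z.2)
  contMDiff := by
    intro z
    rw [contMDiffAt_form_iff]
    have hg := (contMDiffAt_form_iff _ _).1 (g.contMDiff z.1)
    have hh := (contMDiffAt_form_iff _ _).1 (h.contMDiff z.2)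
    have hg' := ContMDiffAt.comp z hg (contMDiffAt_fst (I := I) (J := J) (n := ∞))
    have hh' := ContMDiffAt.comp z hh (contMDiffAt_snd (I := I) (J := J) (n := ∞))
    have hL : ContDiff ℝ ∞ (fun q : (E →L[ℝ] E →L[ℝ] ℝ) × (E' →L[ℝ] E' →L[ℝ] ℝ) => prodForm q.1 q.2) := by
      have : (fun q : (E →L[ℝ] E →L[ℝ] ℝ) × (E' →L[ℝ] E' →L[ℝ] ℝ) => prodForm q.1 q.2) = fun q =>
          ((ContinuousLinearMap.compL ℝ (E × E') E ℝ).flip (.fst ℝ E E')) ∘L q.1 ∘L (.fst ℝ E E')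
          + ((ContinuousLinearMap.compL ℝ (E × E') E' ℝ).flip (.snd ℝ E E')) ∘L q.2 ∘L (.snd ℝ E E') := by
        funext q
        exact ContinuousLinearMap.ext fun v => ContinuousLinearMap.ext fun w => rfl
      rw [this]
      exact (contDiff_const.clm_comp (contDiff_fst.clm_comp contDiff_const)).add
        (contDiff_const.clm_comp (contDiff_snd.clm_comp contDiff_const))
    have := ContMDiffAt.comp z hL.contMDiff.contMDiffAt (hg'.prodMk_space hh')
    refine this.congr_of_eventuallyEq ?_
    filter_upwards [extChartAt_source_mem_nhds (I := I.prod J) z] with y hy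
    have hy' := hy
    rw [extChartAt_prod, PartialEquiv.prod_source] at hy'
    refine ContinuousLinearMap.ext fun v => ContinuousLinearMap.ext fun w => ?_
    rw [coordForm_apply _ _ hy, tangentCoordChange_prod _ _ hy]
    simp only [Function.comp_apply]
    rw [prodForm_apply, coordForm_apply _ _ hy'.1, coordForm_apply _ _ hy'.2]
    rfl

theorem contDiff_add_sum_smul {F W ι : Type*} [NormedAddCommGroup F] [NormedSpace ℝ F]
    [NormedAddCommGroup W] [NormedSpace ℝ W] [Fintype ι] (B : W) (C : ι → W) (c : ι → F → ℝ)
    (hc : ∀ i, ContDiff ℝ ∞ (c i)) : ContDiff ℝ ∞ (fun y => B + ∑ i, c i y • C i) :=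
  contDiff_const.add (ContDiff.sum fun i _ => (hc i).smul contDiff_const)

theorem contMDiff_form {F : Type*} [NormedAddCommGroup F] [NormedSpace ℝ F]
    (s : ∀ x : F, TangentSpace 𝓘(ℝ, F) x →L[ℝ] TangentSpace 𝓘(ℝ, F) x →L[ℝ] ℝ)
    (s' : F → F →L[ℝ] F →L[ℝ] ℝ) (hss : ∀ x, s x = s' x) (hs : ContDiff ℝ ∞ s') :
    ContMDiff 𝓘(ℝ, F) (𝓘(ℝ, F).prod 𝓘(ℝ, F →L[ℝ] F →L[ℝ] ℝ)) ∞
      (fun b ↦ TotalSpace.mk' (F →L[ℝ] F →L[ℝ] ℝ) b (s b)) := by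
  intro x
  rw [contMDiffAt_form_iff]
  refine hs.contMDiff.contMDiffAt.congr_of_eventuallyEq (Filter.Eventually.of_forall fun y => ?_)
  refine ContinuousLinearMap.ext fun v => ContinuousLinearMap.ext fun w => ?_
  rw [coordForm_apply _ _ (by simp [chartAt_self_eq]), tangentCoordChange, TangentBundle.coordChange_model_space, hss]
  rfl

theorem isVonNBounded_of_pos {F : Type*} [NormedAddCommGroup F] [NormedSpace ℝ F]
    [FiniteDimensional ℝ F] (a : F →L[ℝ] F →L[ℝ] ℝ) (ha : ∀ v, v ≠ 0 → 0 < a v v) :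
    Bornology.IsVonNBounded ℝ {v | a v v < 1} := by
  rw [NormedSpace.isVonNBounded_iff]
  have hcont : Continuous fun v => a v v := by fun_prop
  obtain ⟨c, hc, hcv⟩ : ∃ c > 0, ∀ v : F, ‖v‖ = 1 → c ≤ a v v := by
    rcases (Metric.sphere (0 : F) 1).eq_empty_or_nonempty with h | h
    · exact ⟨1, one_pos, fun v hv => by
        have : v ∈ Metric.sphere (0 : F) 1 := by simpa using hv
        rw [h] at this
        exact this.elim⟩
    · have : ProperSpace F := FiniteDimensional.proper ℝ F
      obtain ⟨u, hu, hmin⟩ := (isCompact_sphere (0 : F) 1).exists_isMinOn h hcont.continuousOn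
      have hu1 : ‖u‖ = 1 := by simpa using hu
      refine ⟨a u u, ha u (by rintro rfl; simp at hu1), fun v hv => hmin (by simpa using hv)⟩
  have hall : ∀ v : F, c * ‖v‖ ^ 2 ≤ a v v := fun v => by
    rcases eq_or_ne v 0 with rfl | hv
    · simp
    · have hn : 0 < ‖v‖ := norm_pos_iff.2 hv
      have h1 := hcv (‖v‖⁻¹ • v) (by rw [norm_smul, norm_inv, norm_norm, inv_mul_cancel₀ hn.ne'])
      simp only [map_smul, smul_apply, smul_eq_mul] at h1
      have h2 : ‖v‖⁻¹ * (‖v‖⁻¹ * a v v) * ‖v‖ ^ 2 = a v v := by field_simp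
      nlinarith [mul_le_mul_of_nonneg_right h1 (sq_nonneg ‖v‖)]
  refine isBounded_iff_forall_norm_le.2 ⟨1 + 1 / c, fun v hv => ?_⟩
  have h1 : c * ‖v‖ ^ 2 < 1 := (hall v).trans_lt hv
  have h2 : ‖v‖ ^ 2 < 1 / c := by rw [lt_div_iff₀ hc]; linarith
  nlinarith [norm_nonneg v, sq_nonneg (‖v‖ - 1)]

end Metrics

/-! ### Metrics on Lie groups -/

section LieGroups

variable {E H : Type*} [NormedAddCommGroup E] [NormedSpace ℝ E] [TopologicalSpace H]
  {I : ModelWithCorners ℝ E H}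

/-- `φ` pulls the metric `h` back to the metric `g`. -/
def PreservesMetric {E' H' : Type*} [NormedAddCommGroup E'] [NormedSpace ℝ E'] [TopologicalSpace H']
    {J : ModelWithCorners ℝ E' H'} {M N : Type*}
    [TopologicalSpace M] [ChartedSpace H M] [IsManifold I ∞ M]
    [TopologicalSpace N] [ChartedSpace H' N] [IsManifold J ∞ N]
    (g : RiemannianMetricOn I M) (h : RiemannianMetricOn J N) (φ : M → N) : Prop :=
  ∀ (x : M) (v w : TangentSpace I x),
    h.inner (φ x) (mfderiv I J φ x v) (mfderiv I J φ x w) = g.inner x v w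

variable {G : Type*} [TopologicalSpace G] [ChartedSpace H G] [Group G]

/-- A metric on a Lie group is left-invariant if all left translations preserve it. -/
def IsLeftInvariantMetric [IsManifold I ∞ G] (h : RiemannianMetricOn I G) : Prop :=
  ∀ a : G, PreservesMetric h h (fun x : G => a * x)

/-- The cyclic condition, for the scalar product induced by `h` on the Lie algebra
(the tangent space at `1`, with the bracket of left-invariant vector fields). -/
def IsCyclicMetric [IsManifold I ∞ G] (h : RiemannianMetricOn I G) : Prop :=
  ∀ X Y Z : GroupLieAlgebra I G,
    h.inner 1 ⁅X, Y⁆ Z + h.inner 1 ⁅Y, Z⁆ X + h.inner 1 ⁅Z, X⁆ Y = 0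

/-- Makes the Lie algebra structure of a smooth real Lie group available. -/
instance instLEInftyMinSmoothness : ENat.LEInfty (minSmoothness ℝ 3) :=
  ⟨by rw [minSmoothness_of_isRCLikeNormedField]; exact ENat.LEInfty.out⟩

variable (I G) in
/-- The derived algebra `[𝔤, 𝔤]`. -/
abbrev derivedAlgebra [LieGroup I ∞ G] [CompleteSpace E] : LieIdeal ℝ (GroupLieAlgebra I G) :=
  LieAlgebra.derivedSeries ℝ (GroupLieAlgebra I G) 1

/-- The orthogonal complement of the derived algebra. -/
def derivedOrthogonal [LieGroup I ∞ G] [CompleteSpace E] (h : RiemannianMetricOn I G) :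
    Set (GroupLieAlgebra I G) :=
  {u | ∀ v ∈ derivedAlgebra I G, h.inner 1 u v = 0}

end LieGroups

/-! ### The model groups -/

/-- The vector space `ℝ^q × ℝ^p`. -/
abbrev Space (q p : ℕ) : Type := EuclideanSpace ℝ (Fin q) × EuclideanSpace ℝ (Fin p)

/-- The group `G(q, p, Ω)`: its underlying manifold is `ℝ^q × ℝ^p`, and its product is
`(s, t) (s', t') = (s + s', t + (e^{⟨s, Ω_1⟩} t'_1, …, e^{⟨s, Ω_p⟩} t'_p))`, where `Ω_i` are the
columns of `Ω`. -/
def CyclicModel {q p : ℕ} (_Ω : Matrix (Fin q) (Fin p) ℝ) : Type :=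
  Space q p

namespace CyclicModel
variable {q p : ℕ} (Ω : Matrix (Fin q) (Fin p) ℝ)

instance : TopologicalSpace (CyclicModel Ω) :=
  inferInstanceAs (TopologicalSpace (Space q p))

instance : ChartedSpace (Space q p) (CyclicModel Ω) :=
  inferInstanceAs (ChartedSpace (Space q p) (Space q p))

/-- `⟨s, Ω_i⟩` for the `i`-th column `Ω_i` of `Ω`. -/
def weight (s : EuclideanSpace ℝ (Fin q)) (i : Fin p) : ℝ :=
  inner ℝ s (WithLp.toLp 2 (Ω.col i))

theorem weight_add (s s' : EuclideanSpace ℝ (Fin q)) (i : Fin p) :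
    weight Ω (s + s') i = weight Ω s i + weight Ω s' i := inner_add_left _ _ _

theorem weight_neg (s : EuclideanSpace ℝ (Fin q)) (i : Fin p) :
    weight Ω (-s) i = - weight Ω s i := inner_neg_left _ _

theorem weight_zero (i : Fin p) : weight Ω 0 i = 0 := inner_zero_left _

theorem contDiff_weight (i : Fin p) : ContDiff ℝ ∞ (fun s => weight Ω s i) := by
  exact contDiff_id.inner ℝ contDiff_const

instance : Group (CyclicModel Ω) where
  mul a b := (a.1 + b.1, WithLp.toLp 2 fun i => a.2 i + Real.exp (weight Ω a.1 i) * b.2 i)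
  one := (0, 0)
  inv a := (-a.1, WithLp.toLp 2 fun i => -(Real.exp (-weight Ω a.1 i) * a.2 i))
  mul_assoc a b c := by
    refine Prod.ext (add_assoc a.1 b.1 c.1) (PiLp.ext fun i => ?_)
    change (a.2 i + Real.exp (weight Ω a.1 i) * b.2 i) + Real.exp (weight Ω (a.1 + b.1) i) * c.2 i =
      a.2 i + Real.exp (weight Ω a.1 i) * (b.2 i + Real.exp (weight Ω b.1 i) * c.2 i)
    rw [weight_add, Real.exp_add]
    ring
  one_mul a := by
    refine Prod.ext (zero_add a.1) (PiLp.ext fun i => ?_)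
    change 0 + Real.exp (weight Ω 0 i) * a.2 i = a.2 i
    simp [weight_zero]
  mul_one a := by
    refine Prod.ext (add_zero a.1) (PiLp.ext fun i => ?_)
    change a.2 i + Real.exp (weight Ω a.1 i) * 0 = a.2 i
    simp
  inv_mul_cancel a := by
    refine Prod.ext (neg_add_cancel a.1) (PiLp.ext fun i => ?_)
    change -(Real.exp (-weight Ω a.1 i) * a.2 i) + Real.exp (weight Ω (-a.1) i) * a.2 i = 0
    rw [weight_neg]
    ring

theorem mul_def (a b : CyclicModel Ω) :
    a * b = (a.1 + b.1, WithLp.toLp 2 fun i => a.2 i + Real.exp (weight Ω a.1 i) * b.2 i) := rfl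

theorem contDiff_exp_weight {F : Type*} [NormedAddCommGroup F] [NormedSpace ℝ F] (c : ℝ) (i : Fin p)
    {f : F → EuclideanSpace ℝ (Fin q)} (hf : ContDiff ℝ ∞ f) :
    ContDiff ℝ ∞ (fun x => Real.exp (c * weight Ω (f x) i)) :=
  (contDiff_const.mul ((contDiff_weight Ω i).comp hf)).exp

instance : LieGroup 𝓘(ℝ, Space q p) ∞ (CyclicModel Ω) where
  __ := (inferInstance : IsManifold 𝓘(ℝ, Space q p) ∞ (Space q p))
  contMDiff_mul := by
    have key : ContDiff ℝ ∞ (fun z : Space q p × Space q p => ((z.1.1 + z.2.1,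
        WithLp.toLp 2 fun i => z.1.2 i + Real.exp (1 * weight Ω z.1.1 i) * z.2.2 i) : Space q p)) := by
      refine ContDiff.prodMk (by fun_prop) ?_
      rw [contDiff_euclidean]
      intro i
      have := contDiff_exp_weight Ω 1 i (F := Space q p × Space q p) (f := fun z => z.1.1) (by fun_prop)
      change ContDiff ℝ ∞ fun z : Space q p × Space q p => 
         z.1.2 i + Real.exp (1 * weight Ω z.1.1 i) * z.2.2 i
      fun_prop
    have key2 : ContMDiff (𝓘(ℝ, Space q p).prod 𝓘(ℝ, Space q p)) 𝓘(ℝ, Space q p) ∞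
        (fun z : Space q p × Space q p => ((z.1.1 + z.2.1,
        WithLp.toLp 2 fun i => z.1.2 i + Real.exp (1 * weight Ω z.1.1 i) * z.2.2 i) : Space q p)) := by
      rw [← modelWithCornersSelf_prod, chartedSpaceSelf_prod]
      exact key.contMDiff
    refine key2.congr fun z => ?_
    simp only [one_mul]
    rfl
  contMDiff_inv := by
    have key : ContDiff ℝ ∞ (fun z : Space q p => ((-z.1,
        WithLp.toLp 2 fun i => -(Real.exp (-1 * weight Ω z.1 i) * z.2 i)) : Space q p)) := by
      refine ContDiff.prodMk (by fun_prop) ?_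
      rw [contDiff_euclidean]
      intro i
      have := contDiff_exp_weight Ω (-1) i (F := Space q p) (f := fun z => z.1) (by fun_prop)
      change ContDiff ℝ ∞ fun z : Space q p => -(Real.exp (-1 * weight Ω z.1 i) * z.2 i)
      fun_prop
    refine key.contMDiff.congr fun z => ?_
    simp only [neg_mul, one_mul]
    rfl

/-- The form `dt_i ⊗ dt_i`. -/
def fiberForm (i : Fin p) : Space q p →L[ℝ] Space q p →L[ℝ] ℝ :=
  (ContinuousLinearMap.mul ℝ ℝ).bilinearComp
    (EuclideanSpace.proj i ∘L .snd ℝ (EuclideanSpace ℝ (Fin q)) (EuclideanSpace ℝ (Fin p)))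
    (EuclideanSpace.proj i ∘L .snd ℝ (EuclideanSpace ℝ (Fin q)) (EuclideanSpace ℝ (Fin p)))

/-- The form `∑ ds_j ⊗ ds_j`. -/
def baseForm : Space q p →L[ℝ] Space q p →L[ℝ] ℝ :=
  (innerSL ℝ : EuclideanSpace ℝ (Fin q) →L[ℝ] EuclideanSpace ℝ (Fin q) →L[ℝ] ℝ).bilinearComp
    (.fst ℝ (EuclideanSpace ℝ (Fin q)) (EuclideanSpace ℝ (Fin p)))
    (.fst ℝ (EuclideanSpace ℝ (Fin q)) (EuclideanSpace ℝ (Fin p)))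

/-- The bilinear form `∑ ds_j² + ∑ e^{-2⟨s, Ω_i⟩} dt_i²` at the point `x = (s, t)`. -/
def h0Form (x : CyclicModel Ω) : Space q p →L[ℝ] Space q p →L[ℝ] ℝ :=
  baseForm + ∑ i, Real.exp (-2 * weight Ω x.1 i) • fiberForm i

theorem h0Form_apply (x : CyclicModel Ω) (v w : Space q p) :
    h0Form Ω x v w = ∑ j, v.1 j * w.1 j + ∑ i, Real.exp (-2 * weight Ω x.1 i) * (v.2 i * w.2 i) := by
  simp [h0Form, baseForm, fiberForm, PiLp.inner_apply, mul_comm]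


theorem h0Form_symm (x : CyclicModel Ω) (v w : Space q p) : h0Form Ω x v w = h0Form Ω x w v := by
  simp only [h0Form_apply, mul_comm]

theorem h0Form_pos (x : CyclicModel Ω) (v : Space q p) (hv : v ≠ 0) : 0 < h0Form Ω x v v := by
  rw [h0Form_apply]
  have h1 : 0 ≤ ∑ j, v.1 j * v.1 j := Finset.sum_nonneg fun j _ => mul_self_nonneg _
  have h2 : ∀ i ∈ Finset.univ, 0 ≤ Real.exp (-2 * weight Ω x.1 i) * (v.2 i * v.2 i) := fun i _ =>
    mul_nonneg (Real.exp_pos _).le (mul_self_nonneg _)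
  rcases (add_nonneg h1 (Finset.sum_nonneg h2)).lt_or_eq with h | h
  · exact h
  · refine absurd (Prod.ext (PiLp.ext fun j => ?_) (PiLp.ext fun i => ?_)) hv
    · have := (add_eq_zero_iff_of_nonneg h1 (Finset.sum_nonneg h2)).1 h.symm
      simpa using (Finset.sum_eq_zero_iff_of_nonneg fun j _ => mul_self_nonneg (v.1 j)).1 this.1 j
        (Finset.mem_univ _)
    · have := (add_eq_zero_iff_of_nonneg h1 (Finset.sum_nonneg h2)).1 h.symm
      simpa [Real.exp_ne_zero] using (Finset.sum_eq_zero_iff_of_nonneg h2).1 this.2 i (Finset.mem_univ _)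

/-- The metric `h₀ = ∑ ds_j² + ∑ e^{-2⟨s, Ω_i⟩} dt_i²` of `G(q, p, Ω)`. -/
def h0 : RiemannianMetricOn 𝓘(ℝ, Space q p) (CyclicModel Ω) where
  inner x := h0Form Ω x
  symm x v w := h0Form_symm Ω x v w
  pos x v hv := h0Form_pos Ω x v hv
  isVonNBounded x := isVonNBounded_of_pos _ (h0Form_pos Ω x)
  contMDiff := by
    refine contMDiff_form (F := Space q p) _ (fun y => h0Form Ω y) (fun _ => rfl) ?_
    exact contDiff_add_sum_smul baseForm fiberForm _
      (fun i => contDiff_exp_weight Ω (-2) i contDiff_fst)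
end CyclicModel

/-- The abelian Lie group `ℝ^r`, written multiplicatively. -/
def EuclideanGroup (r : ℕ) : Type := EuclideanSpace ℝ (Fin r)

namespace EuclideanGroup

variable (r : ℕ)

instance : TopologicalSpace (EuclideanGroup r) :=
  inferInstanceAs (TopologicalSpace (EuclideanSpace ℝ (Fin r)))

instance : ChartedSpace (EuclideanSpace ℝ (Fin r)) (EuclideanGroup r) :=
  inferInstanceAs (ChartedSpace (EuclideanSpace ℝ (Fin r)) (EuclideanSpace ℝ (Fin r)))

/-- The group law is the addition of vectors. -/
instance : CommGroup (EuclideanGroup r) :=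
  inferInstanceAs (CommGroup (Multiplicative (EuclideanSpace ℝ (Fin r))))

instance : LieGroup (𝓡 r) ∞ (EuclideanGroup r) where
  __ := (inferInstance : IsManifold (𝓡 r) ∞ (EuclideanSpace ℝ (Fin r)))
  contMDiff_mul := contMDiff_add (G := EuclideanSpace ℝ (Fin r)) (𝓡 r) ∞
  contMDiff_inv := contMDiff_neg (G := EuclideanSpace ℝ (Fin r)) (𝓡 r) ∞

/-- The Euclidean metric of `ℝ^r`. -/
def flatMetric : RiemannianMetricOn (𝓡 r) (EuclideanGroup r) where
  inner _ := (innerSL ℝ :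
    EuclideanSpace ℝ (Fin r) →L[ℝ] EuclideanSpace ℝ (Fin r) →L[ℝ] ℝ)
  symm _ v w := real_inner_comm (F := EuclideanSpace ℝ (Fin r)) w v
  pos _ _ hv := real_inner_self_pos (F := EuclideanSpace ℝ (Fin r)).2 hv
  isVonNBounded _ := isVonNBounded_of_pos (F := EuclideanSpace ℝ (Fin r)) (innerSL ℝ)
    fun _ hv => real_inner_self_pos.2 hv
  contMDiff := contMDiff_form (F := EuclideanSpace ℝ (Fin r)) _ (fun _ => innerSL ℝ)
    (fun _ => rfl) contDiff_const

end EuclideanGroup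

end CyclicLie

end

/-! The cyclic identity reads `⟨[X,Y],Z⟩ - ⟨Y,[X,Z]⟩ = -⟨X,[Y,Z]⟩`, so the failure of `ad_X` to be
symmetric is measured by `⟨X,[Y,Z]⟩`. Hence every `ad_X` is symmetric on an abelian ideal, and
`ad_u` is symmetric on all of `𝔤` when `u` is orthogonal to `D = [𝔤,𝔤]`. A commutator of symmetric
operators is skew, and this is used twice. On an abelian ideal `ad_[X,Y]` is both symmetric and
skew, so it vanishes; then no term of the derived series beyond `D` can be the last nonzero one, and
`D` is abelian (`IsCyclicForm.isLieAbelian_derived`). For `u, v ⊥ D` the skew operator `ad_[u,v]`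
has square zero because `D` is abelian, so it vanishes, and `[u,v] = 0` follows
(`IsCyclicForm.lie_eq_zero_of_orthogonal`).

Thus `Dᗮ` acts on `D` by commuting symmetric operators. The spectral theorem gives an orthonormal
basis `e_i` of `D` of joint eigenvectors. With `a_j` an orthonormal basis of the orthogonal
complement, in `Dᗮ`, of the kernel of the action, and `c_k` one of the kernel, the only nonzero
brackets, up to sign, are `[a_j,e_i] = Ω_ji e_i` (`IsCyclicForm.exists_adapted_basis`).

The isomorphism is then written down by integrating 1-forms. The left-invariant forms dual to `a_j`
and `c_k` are closed, and so is `e^{⟨s,Ω_i⟩}` times the form dual to `e_i`, where `ds_j` is dual to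
`a_j`. On the simply connected `G` they have primitives `s`, `c`, `t` (`exists_global_primitive`).
Since a function is determined by its derivatives along left-invariant fields and its value at `1`,
the map `((s,t),c)` is a homomorphism to the model. Its derivative is a linear isometry at each
point, and a homomorphism of this kind onto a simply connected group is a covering, hence bijective
(`bijective_of_map_nhds_one`). -/

namespace CyclicLie

/-! ### Cyclic scalar products on Lie algebras -/

section LieAlgebraPart

variable {L : Type*} [LieRing L] [LieAlgebra ℝ L]

/-- The cyclic condition for a bilinear form on a Lie algebra. -/
def IsCyclicForm (B : LinearMap.BilinForm ℝ L) : Prop :=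
  ∀ X Y Z : L, B ⁅X, Y⁆ Z + B ⁅Y, Z⁆ X + B ⁅Z, X⁆ Y = 0

variable {B : LinearMap.BilinForm ℝ L}

/-- The cyclic identity has three terms; once the one containing `⁅Y, Z⁆` vanishes, the other two
express the symmetry of `ad_X` on the pair `Y, Z`. -/
theorem IsCyclicForm.ad_symm (hB : IsCyclicForm B) (hs : ∀ x y, B x y = B y x) {X Y Z : L}
    (h : B X ⁅Y, Z⁆ = 0) : B ⁅X, Y⁆ Z = B Y ⁅X, Z⁆ := by
  have h1 := hB X Y Z
  rw [hs ⁅Y, Z⁆ X, h, ← lie_skew Z X, map_neg, LinearMap.neg_apply, hs ⁅X, Z⁆ Y] at h1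
  linarith

/-- Every `ad_X` is symmetric on the abelian ideal `d`. So `ad_[X,Y]` is symmetric there, and also
skew, being the commutator of `ad_X` and `ad_Y`. -/
theorem IsCyclicForm.lie_eq_zero_of_mem_abelian (hB : IsCyclicForm B) (hs : ∀ x y, B x y = B y x)
    (hp : ∀ x, x ≠ 0 → 0 < B x x) (d : LieIdeal ℝ L) (hd : ∀ x ∈ d, ∀ y ∈ d, ⁅x, y⁆ = 0) (X Y : L)
    {z : L} (hz : z ∈ d) : ⁅⁅X, Y⁆, z⁆ = 0 := by
  have sym : ∀ X : L, ∀ y ∈ d, ∀ z ∈ d, B ⁅X, y⁆ z = B y ⁅X, z⁆ := fun X y hy z hz =>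
    hB.ad_symm hs (by simp [hd y hy z hz])
  have mem : ∀ (X : L) {y : L}, y ∈ d → ⁅X, y⁆ ∈ d := fun X y hy => lie_mem_right ℝ L d X y hy
  by_contra hne
  set w := ⁅⁅X, Y⁆, z⁆ with hw
  have hwd : w ∈ d := mem _ hz
  have h1 := sym ⁅X, Y⁆ z hz w hwd
  have h2 : B w w = - B z ⁅⁅X, Y⁆, w⁆ := by
    have h0 : B w w = B (⁅X, ⁅Y, z⁆⁆ - ⁅Y, ⁅X, z⁆⁆) w := by rw [← lie_lie]
    rw [h0, map_sub, LinearMap.sub_apply, sym X _ (mem Y hz) w hwd, sym Y _ hz _ (mem X hwd), sym Y _ (mem X hz) w hwd,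
      sym X _ hz _ (mem Y hwd), lie_lie, map_sub]
    ring
  have h3 := hp w hne
  change B w w = _ at h1
  linarith

/-- If a term `d` of the derived series of index at least 2 is abelian, it is killed by the whole
derived algebra, and the cyclic identity makes it orthogonal to itself, so it is zero. Descending
from a vanishing term shows that the second term is zero. -/
theorem IsCyclicForm.isLieAbelian_derived (hB : IsCyclicForm B) (hs : ∀ x y, B x y = B y x)
    (hp : ∀ x, x ≠ 0 → 0 < B x x) (hsol : LieAlgebra.IsSolvable L) :
    IsLieAbelian (LieAlgebra.derivedSeries ℝ L 1) := by
  obtain ⟨k, hk⟩ := (LieAlgebra.isSolvable_iff ℝ L).1 hsol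
  have key : ∀ j, LieAlgebra.derivedSeries ℝ L (j + 3) = ⊥ → LieAlgebra.derivedSeries ℝ L (j + 2) = ⊥ := by
    intro j hj
    set d := LieAlgebra.derivedSeries ℝ L (j + 2) with hd
    have hab : ∀ x ∈ d, ∀ y ∈ d, ⁅x, y⁆ = 0 := fun x hx y hy => by
      have : ⁅x, y⁆ ∈ LieAlgebra.derivedSeries ℝ L (j + 3) := by
        rw [LieAlgebra.derivedSeries_def, LieAlgebra.derivedSeriesOfIdeal_succ]
        exact LieSubmodule.lie_mem_lie hx hy
      rw [hj] at this
      simpa using this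
    have hcen : ∀ x ∈ LieAlgebra.derivedSeries ℝ L 1, ∀ z ∈ d, ⁅x, z⁆ = 0 := fun x hx z hz => by
      rw [LieAlgebra.derivedSeries_def, LieAlgebra.derivedSeriesOfIdeal_succ,
        LieAlgebra.derivedSeriesOfIdeal_zero, ← LieSubmodule.mem_toSubmodule,
        LieSubmodule.lieIdeal_oper_eq_linear_span'] at hx
      induction hx using Submodule.span_induction with
      | mem x h => obtain ⟨a, -, b, -, rfl⟩ := h
                   exact hB.lie_eq_zero_of_mem_abelian hs hp d hab a b hz
      | zero => simp
      | add x y _ _ h1 h2 => simp [h1, h2]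
      | smul c x _ h1 => simp [h1]
    have hle : LieAlgebra.derivedSeries ℝ L (j + 1) ≤ LieAlgebra.derivedSeries ℝ L 1 :=
      LieAlgebra.derivedSeriesOfIdeal_antitone _ (by omega)
    -- `d` is spanned by brackets of elements `a, b` of the preceding term. That term lies in the
    -- derived algebra, because the index of `d` is at least 2, so `⁅b, z⁆` and `⁅z, a⁆` vanish and
    -- the cyclic identity leaves only `B ⁅a, b⁆ z = 0`.
    have horth : ∀ w ∈ d, ∀ z ∈ d, B w z = 0 := fun w hw z hz => by
      rw [hd, LieAlgebra.derivedSeries_def, LieAlgebra.derivedSeriesOfIdeal_succ,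
        ← LieSubmodule.mem_toSubmodule, LieSubmodule.lieIdeal_oper_eq_linear_span'] at hw
      induction hw using Submodule.span_induction with
      | mem x h =>
        obtain ⟨a, ha, b, hb, rfl⟩ := h
        have := hB a b z
        rw [hcen b (hle hb) z hz, ← lie_skew z a, hcen a (hle ha) z hz] at this
        simpa using this
      | zero => simp
      | add x y _ _ h1 h2 => simp [h1, h2]
      | smul c x _ h1 => simp [h1]
    refine (LieSubmodule.eq_bot_iff _).2 fun x hx => ?_
    by_contra hne
    exact (hp x hne).ne' (horth x hx x hx)
  have h2 : LieAlgebra.derivedSeries ℝ L 2 = ⊥ := by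
    have all : ∀ j, LieAlgebra.derivedSeries ℝ L (j + 2) = ⊥ → LieAlgebra.derivedSeries ℝ L 2 = ⊥ := by
      intro j
      induction j with
      | zero => exact id
      | succ j ih => exact fun h => ih (key j h)
    refine all k (eq_bot_iff.2 ?_)
    rw [← hk]
    exact LieAlgebra.derivedSeriesOfIdeal_antitone _ (by omega)
  exact (LieAlgebra.abelian_iff_derived_succ_eq_bot _ 0).2 (by simpa using h2)

theorem lie_mem_derivedSeries_one (X Y : L) : ⁅X, Y⁆ ∈ LieAlgebra.derivedSeries ℝ L 1 := by
  rw [LieAlgebra.derivedSeries_def, LieAlgebra.derivedSeriesOfIdeal_succ,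
    LieAlgebra.derivedSeriesOfIdeal_zero]
  exact LieSubmodule.lie_mem_lie (LieSubmodule.mem_top _) (LieSubmodule.mem_top _)

theorem lie_eq_zero_of_isLieAbelian (d : LieIdeal ℝ L) [IsLieAbelian d] {x y : L} (hx : x ∈ d)
    (hy : y ∈ d) : ⁅x, y⁆ = 0 :=
  congrArg Subtype.val (trivial_lie_zero d d ⟨x, hx⟩ ⟨y, hy⟩)

/-- Here `ad_u` and `ad_v` are symmetric on all of `L`, so `ad_[u,v]` is skew. Its square is zero
because the derived algebra is abelian, so it vanishes; then `B ⁅u, v⁆ ⁅u, v⁆ = B v ⁅u, ⁅u, v⁆⁆ =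
0`. -/
theorem IsCyclicForm.lie_eq_zero_of_orthogonal (hB : IsCyclicForm B) (hs : ∀ x y, B x y = B y x)
    (hp : ∀ x, x ≠ 0 → 0 < B x x) (hD : IsLieAbelian (LieAlgebra.derivedSeries ℝ L 1))
    {u v : L} (hu : ∀ x ∈ LieAlgebra.derivedSeries ℝ L 1, B u x = 0)
    (hv : ∀ x ∈ LieAlgebra.derivedSeries ℝ L 1, B v x = 0) : ⁅u, v⁆ = 0 := by
  have def0 : ∀ x, B x x = 0 → x = 0 := fun x hx => by
    by_contra hne
    exact (hp x hne).ne' hx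
  have su : ∀ x y, B ⁅u, x⁆ y = B x ⁅u, y⁆ := fun x y =>
    hB.ad_symm hs (hu _ (lie_mem_derivedSeries_one x y))
  have sv : ∀ x y, B ⁅v, x⁆ y = B x ⁅v, y⁆ := fun x y =>
    hB.ad_symm hs (hv _ (lie_mem_derivedSeries_one x y))
  have had : ∀ x : L, ⁅⁅u, v⁆, x⁆ = 0 := fun x => by
    apply def0
    set w := ⁅⁅u, v⁆, x⁆ with hw
    have h0 : ⁅⁅u, v⁆, w⁆ = 0 :=
      lie_eq_zero_of_isLieAbelian _ (lie_mem_derivedSeries_one _ _) (lie_mem_derivedSeries_one _ _)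
    have h1 : B w w = - B x ⁅⁅u, v⁆, w⁆ := by
      have h2 : B w w = B (⁅u, ⁅v, x⁆⁆ - ⁅v, ⁅u, x⁆⁆) w := by rw [← lie_lie]
      rw [h2, map_sub, LinearMap.sub_apply, su, sv, sv, su, lie_lie, map_sub]
      ring
    rw [h1, h0]; simp
  apply def0
  rw [su, ← lie_skew u ⁅u, v⁆, had]
  simp

end LieAlgebraPart

/-! ### Joint diagonalisation and adapted orthonormal bases -/

section LinearAlgebraPart

open Module Module.End

theorem exists_orthonormalBasis_joint_eigenvectors {V ι : Type*} [NormedAddCommGroup V]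
    [InnerProductSpace ℝ V] [FiniteDimensional ℝ V] (T : ι → V →ₗ[ℝ] V)
    (hT : ∀ i, (T i).IsSymmetric) (hc : ∀ i j, Commute (T i) (T j)) :
    ∃ (e : OrthonormalBasis (Fin (finrank ℝ V)) ℝ V) (c : Fin (finrank ℝ V) → ι → ℝ),
      ∀ i k, T i (e k) = c k i • e k := by
  classical
  have hC : Pairwise (Function.onFun Commute T) := fun i j _ => hc i j
  have hint := LinearMap.IsSymmetric.directSum_isInternal_of_pairwise_commute hT hC
  have hor := LinearMap.IsSymmetric.orthogonalFamily_iInf_eigenspaces hT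
  -- The index set `ι` may be infinite, but independence leaves only finitely many nonzero joint
  -- eigenspaces; the decomposition is restricted to these.
  have hfin : {χ : ι → ℝ | (⨅ j, eigenspace (T j) (χ j)) ≠ ⊥}.Finite :=
    WellFoundedGT.finite_ne_bot_of_iSupIndep hint.submodule_iSupIndep
  have := hfin.fintype
  have hint' := DirectSum.isInternal_ne_bot_iff.2 hint
  have hor' := hor.comp (Subtype.val_injective (p := fun χ => (⨅ j, eigenspace (T j) (χ j)) ≠ ⊥))
  have : Fintype {χ : ι → ℝ // (⨅ j, eigenspace (T j) (χ j)) ≠ ⊥} := hfin.fintype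
  refine ⟨hint'.subordinateOrthonormalBasis rfl hor',
    fun k => (hint'.subordinateOrthonormalBasisIndex rfl k hor').1, fun i k => ?_⟩
  have h := hint'.subordinateOrthonormalBasis_subordinate rfl k hor'
  exact mem_eigenspace_iff.1 ((Submodule.mem_iInf _).1 h i)

/-- The basis joins joint eigenvectors in `D`, a basis of `ker T`, and a basis of the orthogonal
complement of `ker T` inside `Dᗮ`. Removing the kernel is what gives `Ω` full rank: its rows are the
joint eigenvalues of operators `T (a j)` that are linearly independent. -/
theorem exists_adapted_orthonormalBasis {V : Type*} [NormedAddCommGroup V]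
    [InnerProductSpace ℝ V] [FiniteDimensional ℝ V] (D : Submodule ℝ V) (T : Dᗮ →ₗ[ℝ] D →ₗ[ℝ] D)
    (hT : ∀ u, (T u).IsSymmetric) (hc : ∀ u v, Commute (T u) (T v)) :
    ∃ (q p r : ℕ) (Ω : Matrix (Fin q) (Fin p) ℝ) (a : Fin q → Dᗮ) (e : Fin p → D) (c : Fin r → Dᗮ)
      (b : OrthonormalBasis (Fin q ⊕ Fin p ⊕ Fin r) ℝ V),
      (∀ j, b (.inl j) = a j) ∧ (∀ i, b (.inr (.inl i)) = e i) ∧ (∀ k, b (.inr (.inr k)) = c k) ∧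
      Ω.transpose.rank = q ∧ (∀ j i, T (a j) (e i) = Ω j i • e i) ∧ ∀ k, T (c k) = 0 := by
  obtain ⟨e, χ, hχ⟩ := exists_orthonormalBasis_joint_eigenvectors T hT hc
  have fr := (LinearMap.ker T).finrank_add_finrank_orthogonal
  have fr2 := D.finrank_add_finrank_orthogonal
  have a := stdOrthonormalBasis ℝ (LinearMap.ker T)ᗮ
  have c := stdOrthonormalBasis ℝ (LinearMap.ker T)
  have ha := a.orthonormal
  have hcc := c.orthonormal
  have he := e.orthonormal
  rw [orthonormal_iff_ite] at ha hcc he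
  let b : Fin (finrank ℝ (LinearMap.ker T)ᗮ) ⊕ Fin (finrank ℝ D) ⊕ Fin (finrank ℝ (LinearMap.ker T)) → V :=
    Sum.elim (fun j => (a j : Dᗮ)) (Sum.elim (fun i => e i) (fun k => (c k : Dᗮ)))
  have hDa : ∀ (u : Dᗮ) (x : D), inner ℝ (u : V) (x : V) = 0 := fun u x =>
    Submodule.inner_left_of_mem_orthogonal x.2 u.2
  have hDa' : ∀ (u : Dᗮ) (x : D), inner ℝ (x : V) (u : V) = 0 := fun u x =>
    Submodule.inner_right_of_mem_orthogonal x.2 u.2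
  have hac : ∀ (u : (LinearMap.ker T : Submodule ℝ Dᗮ)ᗮ) (x : LinearMap.ker T),
      inner ℝ ((u : Dᗮ) : V) ((x : Dᗮ) : V) = 0 := fun u x =>
    Submodule.inner_left_of_mem_orthogonal (K := LinearMap.ker T) x.2 u.2
  have hac' : ∀ (u : (LinearMap.ker T : Submodule ℝ Dᗮ)ᗮ) (x : LinearMap.ker T),
      inner ℝ ((x : Dᗮ) : V) ((u : Dᗮ) : V) = 0 := fun u x =>
    Submodule.inner_right_of_mem_orthogonal (K := LinearMap.ker T) x.2 u.2
  have hb : Orthonormal ℝ b := by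
    rw [orthonormal_iff_ite]
    rintro (j | i | k) (j' | i' | k')
    · simpa [b] using ha j j'
    · simp [b, hDa]
    · simp [b, hac]
    · simp [b, hDa']
    · simpa [b] using he i i'
    · simp [b, hDa']
    · simp [b, hac']
    · simp [b, hDa]
    · simpa [b] using hcc k k'
  have hspan : ⊤ ≤ Submodule.span ℝ (Set.range b) := by
    refine (hb.linearIndependent.span_eq_top_of_card_eq_finrank' ?_).ge
    simp only [Fintype.card_sum, Fintype.card_fin]
    omega
  refine ⟨_, _, _, .of fun j i => χ i (a j), fun j => a j, e, fun k => c k, OrthonormalBasis.mk hb hspan,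
    by simp [b], by simp [b], by simp [b], ?_, fun j i => hχ _ _, fun k => (c k).2⟩
  set Ω : Matrix (Fin (finrank ℝ (LinearMap.ker T)ᗮ)) (Fin (finrank ℝ D)) ℝ := .of fun j i => χ i (a j)
  have hinj : Function.Injective Ω.transpose.mulVecLin := by
    rw [injective_iff_map_eq_zero]
    intro x hx
    -- If `Ωᵗ x = 0`, the combination `∑ x j • a j` acts by zero on every eigenvector `e i`, so it
    -- lies both in `ker T` and in its orthogonal complement.
    have h0 : ∑ j, x j • a j = 0 := by
      have hmem : ((∑ j, x j • a j : (LinearMap.ker T)ᗮ) : Dᗮ) ∈ LinearMap.ker T := by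
        rw [LinearMap.mem_ker]
        refine e.toBasis.ext fun i => ?_
        have hxi := congrFun hx i
        simp only [Matrix.mulVecLin_apply, Matrix.mulVec, dotProduct, Matrix.transpose_apply,
          Pi.zero_apply] at hxi
        simp only [Submodule.coe_sum, Submodule.coe_smul, map_sum, map_smul, LinearMap.sum_apply,
          LinearMap.smul_apply, OrthonormalBasis.coe_toBasis, hχ, smul_smul, ← Finset.sum_smul,
          LinearMap.zero_apply]
        rw [← zero_smul ℝ (e i), ← hxi]
        simp only [Ω, Matrix.of_apply, mul_comm]
      have := hac (∑ j, x j • a j) ⟨_, hmem⟩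
      exact Subtype.ext (Subtype.ext (inner_self_eq_zero.1 this))
    funext j
    exact Fintype.linearIndependent_iff.1 a.toBasis.linearIndependent x (by simpa using h0) j
  rw [Matrix.rank, LinearMap.finrank_range_of_inj hinj]
  simp

/-- The expansion of a vector in an orthonormal basis. -/
theorem eq_sum_smul_of_orthonormal {V ι : Type*} [AddCommGroup V] [Module ℝ V] [Fintype ι] [DecidableEq ι] {B : LinearMap.BilinForm ℝ V} (b : Basis ι ℝ V)
    (hb : ∀ i j, B (b i) (b j) = if i = j then 1 else 0) (u : V) : u = ∑ s, B (b s) u • b s := by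
  conv_lhs => rw [← b.sum_repr u]
  refine Finset.sum_congr rfl fun s _ => ?_
  have : B (b s) (∑ t, b.repr u t • b t) = b.repr u s := by simp [hb, -Basis.sum_repr]
  rw [b.sum_repr] at this
  rw [this]

end LinearAlgebraPart

/-! ### Brackets in an adapted basis -/

section StructureTheorem

open Module

/-- The elements `u` for which `x` is an eigenvector of `ad_u` form a subspace. -/
theorem exists_lie_eq_smul_of_basis {L ι : Type*} [LieRing L] [LieAlgebra ℝ L] (b : Basis ι ℝ L)
    (x : L) (h : ∀ s, ∃ c : ℝ, ⁅b s, x⁆ = c • x) (u : L) : ∃ c : ℝ, ⁅u, x⁆ = c • x := by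
  induction b.mem_span u using Submodule.span_induction with
  | mem y hy => obtain ⟨s, rfl⟩ := hy; exact h s
  | zero => exact ⟨0, by simp⟩
  | add y z _ _ hy hz =>
    obtain ⟨c, hc⟩ := hy
    obtain ⟨d, hd⟩ := hz
    exact ⟨c + d, by rw [add_lie, hc, hd, add_smul]⟩
  | smul t y _ hy =>
    obtain ⟨c, hc⟩ := hy
    exact ⟨t * c, by rw [smul_lie, hc, smul_smul]⟩

variable {L : Type*} [LieRing L] [LieAlgebra ℝ L] [FiniteDimensional ℝ L]
  {B : LinearMap.BilinForm ℝ L}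

/-- The structure of a solvable cyclic Lie algebra, in an adapted orthonormal basis. -/
theorem IsCyclicForm.exists_adapted_basis (hB : IsCyclicForm B) (hs : ∀ x y, B x y = B y x)
    (hp : ∀ x, x ≠ 0 → 0 < B x x) (hD : IsLieAbelian (LieAlgebra.derivedSeries ℝ L 1)) :
    ∃ (q p r : ℕ) (Ω : Matrix (Fin q) (Fin p) ℝ) (b : Basis (Fin q ⊕ Fin p ⊕ Fin r) ℝ L),
      Ω.transpose.rank = q ∧
      (∀ i j, B (b i) (b j) = if i = j then 1 else 0) ∧
      (∀ (u v : L) j, B (b (.inl j)) ⁅u, v⁆ = 0) ∧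
      (∀ (u v : L) k, B (b (.inr (.inr k))) ⁅u, v⁆ = 0) ∧
      (∀ (u v : L) i, B (b (.inr (.inl i))) ⁅u, v⁆ = ∑ j, Ω j i *
        (B (b (.inl j)) u * B (b (.inr (.inl i))) v - B (b (.inl j)) v * B (b (.inr (.inl i))) u)) ∧
      (∀ u : L, (∀ v ∈ LieAlgebra.derivedSeries ℝ L 1, B u v = 0) → ∀ i, ∃ c : ℝ, ⁅u, b i⁆ = c • b i) := by
  classical
  -- `B` is made the inner product of `L`, so that orthogonal complements and the spectral theorem
  -- apply to it.
  let core : InnerProductSpace.Core ℝ L :=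
    { inner x y := B x y
      conj_inner_symm x y := hs y x
      re_inner_nonneg x := by
        rcases eq_or_ne x 0 with rfl | h
        · simp
        · exact (hp x h).le
      add_left x y z := by simp
      smul_left x y r := by simp
      definite x hx := by
        by_contra hne
        exact (hp x hne).ne' hx }
  let _ : NormedAddCommGroup L := core.toNormedAddCommGroup
  let _ : InnerProductSpace ℝ L := .ofCore core.toCore
  have hin : ∀ x y : L, inner ℝ x y = B x y := fun _ _ => rfl
  set D : LieIdeal ℝ L := LieAlgebra.derivedSeries ℝ L 1 with hDdef
  let Ds : Submodule ℝ L := D.toSubmodule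
  have hmem : ∀ X Y : L, ⁅X, Y⁆ ∈ D := lie_mem_derivedSeries_one
  have hab : ∀ {x y : L}, x ∈ D → y ∈ D → ⁅x, y⁆ = 0 := lie_eq_zero_of_isLieAbelian D
  have hperp : ∀ u ∈ Dsᗮ, ∀ v ∈ D, B u v = 0 := fun u hu v hv =>
    (hin u v) ▸ Submodule.inner_left_of_mem_orthogonal (K := Ds) hv hu
  have hpp : ∀ u ∈ Dsᗮ, ∀ v ∈ Dsᗮ, ⁅u, v⁆ = 0 := fun u hu v hv =>
    hB.lie_eq_zero_of_orthogonal hs hp hD (hperp u hu) (hperp v hv)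
  have hsym : ∀ u ∈ Dsᗮ, ∀ x y : L, B ⁅u, x⁆ y = B x ⁅u, y⁆ := fun u hu x y =>
    hB.ad_symm hs (hperp u hu _ (hmem x y))
  let T : Dsᗮ →ₗ[ℝ] Ds →ₗ[ℝ] Ds := LinearMap.mk₂ ℝ (fun u x => ⟨⁅(u : L), (x : L)⁆, hmem _ _⟩)
    (fun _ _ _ => Subtype.ext (add_lie _ _ _)) (fun _ _ _ => Subtype.ext (smul_lie _ _ _))
    (fun _ _ _ => Subtype.ext (lie_add _ _ _)) (fun _ _ _ => Subtype.ext (lie_smul _ _ _))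
  have hTa : ∀ u x, ((T u x : Ds) : L) = ⁅(u : L), (x : L)⁆ := fun _ _ => rfl
  obtain ⟨q, p, r, Ω, a, e, c, b, hba, hbe, hbc, hΩ, hae, hc⟩ :=
    exists_adapted_orthonormalBasis Ds T (fun u x y => hsym u u.2 x y) (fun u v => by
      refine LinearMap.ext fun x => Subtype.ext ?_
      change ⁅(u : L), ⁅(v : L), (x : L)⁆⁆ = ⁅(v : L), ⁅(u : L), (x : L)⁆⁆
      rw [leibniz_lie, hpp u u.2 v v.2]; simp)
  have hae' : ∀ j i, ⁅(a j : L), (e i : L)⁆ = Ω j i • (e i : L) := fun j i => by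
    rw [← hTa, hae]; rfl
  have hce' : ∀ k, ∀ x ∈ D, ⁅(c k : L), x⁆ = 0 := fun k x hx => by
    have := hTa (c k) ⟨x, hx⟩
    rw [hc] at this
    simpa using this.symm
  have hbon := orthonormal_iff_ite.1 b.orthonormal
  have heD : ∀ i, (e i : L) ∈ D := fun i => (e i).2
  refine ⟨q, p, r, Ω, b.toBasis, hΩ, fun i j => ?_, fun u v j => ?_, fun u v k => ?_, fun u v i => ?_,
    fun u hu i => ?_⟩
  · simpa using! hbon i j
  · simpa [hba] using hperp _ (a j).2 _ (hmem u v)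
  · simpa [hbc] using hperp _ (c k).2 _ (hmem u v)
  · let F : LinearMap.BilinForm ℝ L := LinearMap.mk₂ ℝ (fun u v => B (b (.inr (.inl i))) ⁅u, v⁆)
      (fun _ _ _ => by simp) (fun _ _ _ => by simp) (fun _ _ _ => by simp) (fun _ _ _ => by simp)
    let F' : LinearMap.BilinForm ℝ L := LinearMap.mk₂ ℝ (fun u v => ∑ j, Ω j i *
        (B (b (.inl j)) u * B (b (.inr (.inl i))) v - B (b (.inl j)) v * B (b (.inr (.inl i))) u))
      (fun _ _ _ => by simp only [map_add, ← Finset.sum_add_distrib]; congr 1; funext; ring)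
      (fun _ _ _ => by simp only [map_smul, smul_eq_mul, Finset.mul_sum]; congr 1; funext; ring)
      (fun _ _ _ => by simp only [map_add, ← Finset.sum_add_distrib]; congr 1; funext; ring)
      (fun _ _ _ => by simp only [map_smul, smul_eq_mul, Finset.mul_sum]; congr 1; funext; ring)
    -- Both sides are bilinear in `u, v`, so pairs of basis vectors suffice; only the pairs `(a, e)`
    -- and `(e, a)` give nonzero brackets.
    have : F = F' := by
      refine LinearMap.BilinForm.ext_basis b.toBasis fun s t => ?_
      simp only [OrthonormalBasis.coe_toBasis]
      change B (b (.inr (.inl i))) ⁅b s, b t⁆ = ∑ j, Ω j i *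
        (B (b (.inl j)) (b s) * B (b (.inr (.inl i))) (b t) -
          B (b (.inl j)) (b t) * B (b (.inr (.inl i))) (b s))
      have hbon' : ∀ s t, B (b s) (b t) = if s = t then 1 else 0 := hbon
      rcases s with j | i' | k <;> rcases t with j' | i'' | k' <;>
        simp only [hbon', reduceCtorEq, if_false, mul_zero, zero_mul, sub_zero, zero_sub,
          Finset.sum_const_zero, Sum.inl.injEq, Sum.inr.injEq]
      · rw [hba, hba, hpp _ (a j).2 _ (a j').2, map_zero]
      · rw [hba, hbe i'', hae', map_smul, ← hbe, hbon']
        simp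
        grind
      · rw [hba, hbc, hpp _ (a j).2 _ (c k').2, map_zero]
      · rw [hba, hbe i', ← lie_skew, hae', map_neg, map_smul, ← hbe, hbon']
        simp
        grind
      · rw [hbe, hbe i', hbe i'', hab (heD _) (heD _), map_zero]
      · rw [hbe i', hbc, ← lie_skew, hce' _ _ (heD _), neg_zero, map_zero]
      · rw [hba, hbc, hpp _ (c k).2 _ (a j').2, map_zero]
      · rw [hbe i'', hbc, hce' _ _ (heD _), map_zero]
      · rw [hbc, hbc, hpp _ (c k).2 _ (c k').2, map_zero]
    have h := LinearMap.congr_fun (LinearMap.congr_fun this u) v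
    simpa [F, F'] using h
  · have hu' : u ∈ Dsᗮ := (Submodule.mem_orthogonal' _ _).2 fun v hv => hu v hv
    rcases i with j | i | k
    · exact ⟨0, by simp [hba, hpp u hu' _ (a j).2]⟩
    · refine exists_lie_eq_smul_of_basis b.toBasis _ (fun s => ?_) u
      simp only [OrthonormalBasis.coe_toBasis, hbe]
      rcases s with j | i' | k
      · exact ⟨Ω j i, by rw [hba, hae']⟩
      · exact ⟨0, by rw [hbe, hab (heD _) (heD _), zero_smul]⟩
      · exact ⟨0, by rw [hbc, hce' _ _ (heD _), zero_smul]⟩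
    · exact ⟨0, by simp [hbc, hpp u hu' _ (c k).2]⟩

end StructureTheorem

/-! ### Left-invariant frames in a chart and local primitives -/

section Primitives

open VectorField Set

variable {E : Type*} [NormedAddCommGroup E] [NormedSpace ℝ E]

/-- The Poincaré lemma for a `1`-form given by its values on a frame `U`. -/
theorem exists_primitive_of_frame [FiniteDimensional ℝ E] {S : Set E} (hS : IsOpen S) (hSc : Convex ℝ S)
    (U : E → E →L[ℝ] E) (hU : ContDiffOn ℝ ∞ U S) (hinv : ∀ y ∈ S, (U y).IsInvertible)
    (br : E → E → E)
    (hbr : ∀ y ∈ S, ∀ u v, lieBracket ℝ (fun z => U z u) (fun z => U z v) y = U y (br u v))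
    (W : E → ℝ) (hW : ContDiffOn ℝ ∞ W S) (l : E →L[ℝ] ℝ)
    (hcl : ∀ y ∈ S, ∀ u v, fderiv ℝ W y (U y u) * l v - fderiv ℝ W y (U y v) * l u =
      W y * l (br u v)) :
    ∃ F : E → ℝ, ContDiffOn ℝ ∞ F S ∧ ∀ y ∈ S, ∀ u, fderiv ℝ F y (U y u) = W y * l u := by
  have : CompleteSpace E := FiniteDimensional.complete ℝ E
  -- The 1-form taking the value `W * l u` on the frame field `U u`.
  let β : E → E →L[ℝ] ℝ := fun y => W y • (l ∘L (U y).inverse)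
  have hβ : ContDiffOn ℝ ∞ β S := by
    refine hW.smul (contDiffOn_const.clm_comp fun y hy => ?_)
    obtain ⟨e, he⟩ := hinv y hy
    have h1 := contDiffAt_map_inverse (𝕜 := ℝ) (n := ∞) e
    rw [he] at h1
    exact h1.comp_contDiffWithinAt y (hU y hy)
  have hβU : ∀ y ∈ S, ∀ u, β y (U y u) = W y * l u := fun y hy u => by
    obtain ⟨e, he⟩ := hinv y hy
    simp [β, ← he]
  have hβd : DifferentiableOn ℝ β S := hβ.differentiableOn (by simp)
  -- Symmetry of the derivative is closedness of `β`. Differentiating `β (U u) = W * l u` along `U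
  -- v`, and antisymmetrising, gives `dβ(U u, U v) = dW(U u) l v - dW(U v) l u - β([U u, U v])`,
  -- which vanishes by `hbr` and `hcl`.
  have hsymm : ∀ y ∈ S, ∀ a b, fderiv ℝ β y a b = fderiv ℝ β y b a := by
    intro y hy a b
    obtain ⟨e, he⟩ := hinv y hy
    obtain ⟨u, rfl⟩ : ∃ u, U y u = a := ⟨e.symm a, by simp [← he]⟩
    obtain ⟨v, rfl⟩ : ∃ v, U y v = b := ⟨e.symm b, by simp [← he]⟩
    have hn : S ∈ 𝓝 y := hS.mem_nhds hy
    have hβy := (hβd.differentiableAt hn).hasFDerivAt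
    have hUy : ∀ u, HasFDerivAt (fun z => U z u) (fderiv ℝ (fun z => U z u) y) y := fun u =>
      DifferentiableAt.hasFDerivAt
        (((hU.differentiableOn (by simp)).differentiableAt hn).clm_apply (differentiableAt_const u))
    have hWy := ((hW.differentiableOn (by simp)).differentiableAt hn).hasFDerivAt
    have key : ∀ u z, fderiv ℝ β y z (U y u) + β y (fderiv ℝ (fun x => U x u) y z) =
        fderiv ℝ W y z * l u := fun u z => by
      have h1 := hβy.clm_apply (hUy u)
      have h2 := (hWy.mul_const (l u)).congr_of_eventuallyEq
        (Filter.eventuallyEq_of_mem hn fun z hz => hβU z hz u)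
      have h3 := congrArg (fun T : E →L[ℝ] ℝ => T z) (h1.unique h2)
      simp at h3
      linarith
    have h1 := key v (U y u)
    have h2 := key u (U y v)
    have h3 := hbr y hy u v
    have h4 := congrArg (β y) h3
    rw [lieBracket_eq, hβU y hy, map_sub] at h4
    have h5 := hcl y hy u v
    linarith
  obtain ⟨F, hF⟩ := hSc.exists_forall_hasFDerivAt_of_fderiv_symmetric hS hβd hsymm
  refine ⟨F, ?_, fun y hy u => by rw [(hF y hy).fderiv, hβU y hy]⟩
  rw [contDiffOn_infty_iff_fderiv_of_isOpen hS]
  exact ⟨fun y hy => (hF y hy).differentiableAt.differentiableWithinAt,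
    hβ.congr fun y hy => (hF y hy).fderiv⟩

variable {G : Type*} [TopologicalSpace G] [ChartedSpace E G] [Group G] [LieGroup 𝓘(ℝ, E) ∞ G]

/-- Left-invariant vector fields on a smooth Lie group are smooth. -/
theorem contMDiff_infty_mulInvariantVectorField (v : GroupLieAlgebra 𝓘(ℝ, E) G) :
    ContMDiff 𝓘(ℝ, E) 𝓘(ℝ, E).tangent ∞
      (fun g : G => (⟨g, mulInvariantVectorField v g⟩ : TangentBundle 𝓘(ℝ, E) G)) := by
  -- The field at `g` is the image of `(0_g, v)` under the derivative of the multiplication at `(g,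
  -- 1)`, which is smooth in `g`.
  let fg : G → TangentBundle 𝓘(ℝ, E) G := fun g => TotalSpace.mk' E g 0
  have sfg : ContMDiff 𝓘(ℝ, E) 𝓘(ℝ, E).tangent ∞ fg := contMDiff_zeroSection _ _
  let fv : G → TangentBundle 𝓘(ℝ, E) G := fun _ => TotalSpace.mk' E 1 v
  have sfv : ContMDiff 𝓘(ℝ, E) 𝓘(ℝ, E).tangent ∞ fv := contMDiff_const
  let F₂ : (TangentBundle 𝓘(ℝ, E) G × TangentBundle 𝓘(ℝ, E) G) →
      TangentBundle (𝓘(ℝ, E).prod 𝓘(ℝ, E)) (G × G) :=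
    (equivTangentBundleProd 𝓘(ℝ, E) G 𝓘(ℝ, E) G).symm
  have S₂ : ContMDiff (𝓘(ℝ, E).tangent.prod 𝓘(ℝ, E).tangent) (𝓘(ℝ, E).prod 𝓘(ℝ, E)).tangent ∞ F₂ :=
    contMDiff_equivTangentBundleProd_symm
  let F₃ : TangentBundle (𝓘(ℝ, E).prod 𝓘(ℝ, E)) (G × G) → TangentBundle 𝓘(ℝ, E) G :=
    tangentMap (𝓘(ℝ, E).prod 𝓘(ℝ, E)) 𝓘(ℝ, E) (fun p : G × G => p.1 * p.2)
  have S₃ : ContMDiff (𝓘(ℝ, E).prod 𝓘(ℝ, E)).tangent 𝓘(ℝ, E).tangent ∞ F₃ :=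
    (contMDiff_mul 𝓘(ℝ, E) ∞).contMDiff_tangentMap (by simp)
  refine ((S₃.comp S₂).comp (sfg.prodMk sfv)).congr fun g => ?_
  refine TotalSpace.ext (by simp [F₂, F₃, fg, fv, tangentMap]) (heq_of_eq ?_)
  have h := mfderiv_prod_eq_add_apply (I := 𝓘(ℝ, E)) (I' := 𝓘(ℝ, E)) (I'' := 𝓘(ℝ, E)) (p := (g, (1 : G)))
    (v := ((0 : E), (v : E)))
    ((contMDiff_mul 𝓘(ℝ, E) ∞ (G := G)).mdifferentiableAt (by simp))
  refine Eq.trans ?_ h.symm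
  simp only [mulInvariantVectorField]
  have h0 : ∀ T : E →L[ℝ] E, T (0 : E) = 0 := fun T => map_zero T
  exact ((congrArg₂ (· + ·) (h0 _) rfl).trans (zero_add _)).symm

/-- The left-invariant frame, read in the chart at `x₀`. -/
noncomputable def chartFrame (x₀ : G) (y : E) : E →L[ℝ] E :=
  (mfderiv 𝓘(ℝ, E) 𝓘(ℝ, E) (extChartAt 𝓘(ℝ, E) x₀).symm y).inverse ∘L
    (mfderiv 𝓘(ℝ, E) 𝓘(ℝ, E) (fun x : G => (extChartAt 𝓘(ℝ, E) x₀).symm y * x) 1)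

theorem isInvertible_mfderiv_mul_left (g h : G) :
    (mfderiv 𝓘(ℝ, E) 𝓘(ℝ, E) (fun x : G => g * x) h).IsInvertible := by
  have d : ∀ g h : G, MDifferentiableAt 𝓘(ℝ, E) 𝓘(ℝ, E) (fun x : G => g * x) h := fun g h =>
    (contMDiff_mul_left (I := 𝓘(ℝ, E)) (n := ∞)).mdifferentiableAt (by simp)
  have A : ∀ g h : G, (mfderiv 𝓘(ℝ, E) 𝓘(ℝ, E) (fun x : G => g⁻¹ * x) (g * h)).comp
      (mfderiv 𝓘(ℝ, E) 𝓘(ℝ, E) (fun x : G => g * x) h) = ContinuousLinearMap.id _ _ := fun g h => by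
    rw [← mfderiv_comp (I' := 𝓘(ℝ, E)) h (d _ _) (d _ _)]
    have : (fun x ↦ g⁻¹ * x) ∘ (fun x ↦ g * x) = (id : G → G) := by ext x; simp
    rw [this, mfderiv_id]
  have B := A g⁻¹ (g * h)
  rw [inv_inv, inv_mul_cancel_left] at B
  exact ContinuousLinearMap.IsInvertible.of_inverse B (A g h)

theorem isInvertible_mfderiv_extChartAt_symm (x₀ : G) {y : E}
    (hy : y ∈ (extChartAt 𝓘(ℝ, E) x₀).target) :
    (mfderiv 𝓘(ℝ, E) 𝓘(ℝ, E) (extChartAt 𝓘(ℝ, E) x₀).symm y).IsInvertible := by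
  have : IsManifold 𝓘(ℝ, E) 1 G := .of_le (n := ∞) (by simp)
  have h := isInvertible_mfderivWithin_extChartAt_symm (I := 𝓘(ℝ, E)) hy
  rwa [ModelWithCorners.Boundaryless.range_eq_univ, mfderivWithin_univ] at h

theorem contMDiffAt_extChartAt_symm (x₀ : G) {y : E}
    (hy : y ∈ (extChartAt 𝓘(ℝ, E) x₀).target) :
    ContMDiffAt 𝓘(ℝ, E) 𝓘(ℝ, E) ∞ (extChartAt 𝓘(ℝ, E) x₀).symm y :=
  (contMDiffOn_extChartAt_symm x₀).contMDiffAt ((isOpen_extChartAt_target x₀).mem_nhds hy)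

theorem isInvertible_chartFrame (x₀ : G) {y : E} (hy : y ∈ (extChartAt 𝓘(ℝ, E) x₀).target) :
    (chartFrame x₀ y).IsInvertible :=
  ContinuousLinearMap.IsInvertible.comp
    (ContinuousLinearMap.IsInvertible.inverse (isInvertible_mfderiv_extChartAt_symm x₀ hy))
    (isInvertible_mfderiv_mul_left _ _)

/-- The derivative at `x` of `f` along the left-invariant vector field defined by `u`. -/
noncomputable def invDeriv {F : Type*} [NormedAddCommGroup F] [NormedSpace ℝ F] (f : G → F) (x : G)
    (u : E) : F :=
  mfderiv 𝓘(ℝ, E) 𝓘(ℝ, F) f x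
    (mulInvariantVectorField (I := 𝓘(ℝ, E)) (u : GroupLieAlgebra 𝓘(ℝ, E) G) x)

theorem fderiv_comp_extChartAt_symm (x₀ : G) {y : E} (hy : y ∈ (extChartAt 𝓘(ℝ, E) x₀).target)
    {f : G → ℝ} (hf : MDifferentiableAt 𝓘(ℝ, E) 𝓘(ℝ, ℝ) f ((extChartAt 𝓘(ℝ, E) x₀).symm y))
    (u : E) :
    fderiv ℝ (f ∘ (extChartAt 𝓘(ℝ, E) x₀).symm) y (chartFrame x₀ y u) =
      invDeriv f ((extChartAt 𝓘(ℝ, E) x₀).symm y) u := by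
  rw [← mfderiv_eq_fderiv, mfderiv_comp (I' := 𝓘(ℝ, E)) y hf
    ((contMDiffAt_extChartAt_symm x₀ hy).mdifferentiableAt (by simp))]
  refine congrArg (mfderiv 𝓘(ℝ, E) 𝓘(ℝ, ℝ) f ((extChartAt 𝓘(ℝ, E) x₀).symm y)) ?_
  obtain ⟨e, he⟩ := isInvertible_mfderiv_extChartAt_symm x₀ hy
  change mfderiv 𝓘(ℝ, E) 𝓘(ℝ, E) (extChartAt 𝓘(ℝ, E) x₀).symm y
    ((mfderiv 𝓘(ℝ, E) 𝓘(ℝ, E) (extChartAt 𝓘(ℝ, E) x₀).symm y).inverse _) = _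
  rw [← he, ContinuousLinearMap.inverse_equiv]
  exact e.apply_symm_apply _

variable [CompleteSpace E]

theorem contDiffOn_chartFrame [FiniteDimensional ℝ E] (x₀ : G) :
    ContDiffOn ℝ ∞ (chartFrame x₀) (extChartAt 𝓘(ℝ, E) x₀).target := by
  rw [contDiffOn_clm_apply]
  intro u y hy
  have : IsManifold 𝓘(ℝ, E) 1 G := .of_le (n := ∞) (by simp)
  have h := ContMDiffAt.mpullback_vectorField_preimage (m := ∞)
    ((contMDiff_infty_mulInvariantVectorField (G := G) u) _)
    (contMDiffAt_extChartAt_symm x₀ hy) (isInvertible_mfderiv_extChartAt_symm x₀ hy) (by simp)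
  exact (contMDiffAt_vectorSpace_iff_contDiffAt.1 h).contDiffWithinAt

variable (G) in
/-- The bracket of the Lie algebra of `G`, on the model vector space. -/
noncomputable def modelBracket (u v : E) : E :=
  Bracket.bracket (L := GroupLieAlgebra 𝓘(ℝ, E) G) (M := GroupLieAlgebra 𝓘(ℝ, E) G) u v

theorem mpullback_extChartAt_symm_bracket (x₀ : G) {y : E}
    (hy : y ∈ (extChartAt 𝓘(ℝ, E) x₀).target) (u v : GroupLieAlgebra 𝓘(ℝ, E) G) :
    mpullback 𝓘(ℝ, E) 𝓘(ℝ, E) (extChartAt 𝓘(ℝ, E) x₀).symm (mulInvariantVectorField ⁅u, v⁆) y =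
      lieBracketWithin ℝ
        (mpullback 𝓘(ℝ, E) 𝓘(ℝ, E) (extChartAt 𝓘(ℝ, E) x₀).symm (mulInvariantVectorField u))
        (mpullback 𝓘(ℝ, E) 𝓘(ℝ, E) (extChartAt 𝓘(ℝ, E) x₀).symm (mulInvariantVectorField v))
        univ y := by
  rw [← mlieBracketWithin_eq_lieBracketWithin, mlieBracketWithin_univ,
    ← mpullback_mlieBracket (n := ∞) (mdifferentiableAt_mulInvariantVectorField u)
    (mdifferentiableAt_mulInvariantVectorField v) (contMDiffAt_extChartAt_symm x₀ hy)
    (by rw [minSmoothness_of_isRCLikeNormedField]; exact ENat.LEInfty.out),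
    ← mulInvariantVector_mlieBracket]
  rfl

/-- Pullback by the inverse chart commutes with Lie brackets, and brackets of left-invariant fields
are left-invariant; so the structure constants of the frame are those of the Lie algebra, at every
point. -/
theorem lieBracket_chartFrame (x₀ : G) {y : E} (hy : y ∈ (extChartAt 𝓘(ℝ, E) x₀).target) (u v : E) :
    lieBracket ℝ (fun z => chartFrame x₀ z u) (fun z => chartFrame x₀ z v) y =
      chartFrame x₀ y (modelBracket G u v) :=
  (congrFun (lieBracketWithin_univ (𝕜 := ℝ) (V := fun z => chartFrame x₀ z u)
    (W := fun z => chartFrame x₀ z v)) y).symm.trans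
    (mpullback_extChartAt_symm_bracket x₀ hy u v).symm

/-- Local primitives of closed `1`-forms given by their values on left-invariant fields. -/
theorem exists_local_primitive [FiniteDimensional ℝ E] (w : G → ℝ)
    (hw : ContMDiff 𝓘(ℝ, E) 𝓘(ℝ, ℝ) ∞ w) (l : E →L[ℝ] ℝ)
    (hcl : ∀ (x : G) (u v : E),
      invDeriv w x u * l v - invDeriv w x v * l u = w x * l (modelBracket G u v)) (x₀ : G) :
    ∃ (O : Set G) (F : G → ℝ), IsOpen O ∧ x₀ ∈ O ∧ ContMDiffOn 𝓘(ℝ, E) 𝓘(ℝ, ℝ) ∞ F O ∧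
      ∀ x ∈ O, ∀ u, invDeriv F x u = w x * l u := by
  set e := extChartAt 𝓘(ℝ, E) x₀ with he
  -- A ball in the chart is convex, as the Poincaré lemma requires.
  obtain ⟨ε, hε, hball⟩ := Metric.isOpen_iff.1 (isOpen_extChartAt_target (I := 𝓘(ℝ, E)) x₀) (e x₀)
    (mem_extChartAt_target x₀)
  have hW : ContDiffOn ℝ ∞ (w ∘ e.symm) e.target := by
    rw [← contMDiffOn_iff_contDiffOn]
    exact hw.comp_contMDiffOn (contMDiffOn_extChartAt_symm x₀)
  obtain ⟨F, hF, hFU⟩ := exists_primitive_of_frame Metric.isOpen_ball (convex_ball (e x₀) ε)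
    (chartFrame x₀) ((contDiffOn_chartFrame x₀).mono hball)
    (fun y hy => isInvertible_chartFrame x₀ (hball hy)) (modelBracket G)
    (fun y hy u v => lieBracket_chartFrame x₀ (hball hy) u v)
    (w ∘ e.symm) (hW.mono hball) l
    (fun y hy u v => by
      rw [fderiv_comp_extChartAt_symm x₀ (hball hy) (hw.mdifferentiableAt (by simp)),
        fderiv_comp_extChartAt_symm x₀ (hball hy) (hw.mdifferentiableAt (by simp))]
      exact hcl _ u v)
  have hO : IsOpen (e.source ∩ e ⁻¹' Metric.ball (e x₀) ε) :=
    (continuousOn_extChartAt x₀).isOpen_inter_preimage (isOpen_extChartAt_source x₀) Metric.isOpen_ball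
  have hFO : ContMDiffOn 𝓘(ℝ, E) 𝓘(ℝ, ℝ) ∞ (F ∘ e) (e.source ∩ e ⁻¹' Metric.ball (e x₀) ε) := by
    refine (contMDiffOn_iff_contDiffOn.2 hF).comp ((contMDiffOn_extChartAt (n := ∞)).mono ?_) inter_subset_right
    rw [he, extChartAt_source]
    exact inter_subset_left
  refine ⟨_, F ∘ e, hO, ⟨mem_extChartAt_source x₀, Metric.mem_ball_self hε⟩, hFO, fun x hx u => ?_⟩
  have hy := hball hx.2
  have hxe : e.symm (e x) = x := e.left_inv hx.1
  have h1 := fderiv_comp_extChartAt_symm x₀ hy (f := F ∘ e) (by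
    rw [← he, hxe]; exact (hFO.contMDiffAt (hO.mem_nhds hx)).mdifferentiableAt (by simp)) u
  have h2 : (F ∘ e) ∘ e.symm =ᶠ[𝓝 (e x)] F :=
    Filter.eventuallyEq_of_mem (Metric.isOpen_ball.mem_nhds hx.2) fun z hz => by
      simp [e.right_inv (hball hz)]
  rw [← he, h2.fderiv_eq, hFU _ hx.2] at h1
  simp only [Function.comp_apply, hxe] at h1
  exact h1.symm

end Primitives

/-- The real numbers with the discrete topology. -/
def DiscreteReal : Type := ℝ

instance : TopologicalSpace DiscreteReal := ⊥

instance : DiscreteTopology DiscreteReal := ⟨rfl⟩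

/-- Translation by a real number on the discrete real line. -/
def DiscreteReal.shift (v : DiscreteReal) (c : ℝ) : DiscreteReal :=
  (HAdd.hAdd (α := ℝ) (β := ℝ) v c : ℝ)

theorem DiscreteReal.shift_zero (v : DiscreteReal) : v.shift 0 = v := add_zero (M := ℝ) v

theorem DiscreteReal.shift_shift (v : DiscreteReal) (c d : ℝ) :
    (v.shift c).shift d = v.shift (c + d) := add_assoc (G := ℝ) v c d

/-! ### Uniqueness and global existence of primitives -/

section GlobalPrimitives

open Set

variable {E : Type*} [NormedAddCommGroup E] [NormedSpace ℝ E]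
  {G : Type*} [TopologicalSpace G] [ChartedSpace E G] [Group G]

theorem invDeriv_sub {f g : G → ℝ} {x : G} (hf : MDifferentiableAt 𝓘(ℝ, E) 𝓘(ℝ, ℝ) f x)
    (hg : MDifferentiableAt 𝓘(ℝ, E) 𝓘(ℝ, ℝ) g x) (u : E) :
    invDeriv (fun y => f y - g y) x u = invDeriv f x u - invDeriv g x u := by
  have h := (hf.hasMFDerivAt.sub hg.hasMFDerivAt).mfderiv
  exact congrArg (fun T : E →L[ℝ] ℝ => T (mulInvariantVectorField (I := 𝓘(ℝ, E)) (u : GroupLieAlgebra 𝓘(ℝ, E) G) x)) h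

variable [LieGroup 𝓘(ℝ, E) ∞ G]

/-- Left-invariant fields span every tangent space, so the derivative of `f` in a chart vanishes on
a small ball, which is connected. -/
theorem eventually_eq_of_invDeriv_eq_zero {O : Set G} (hO : IsOpen O) {f : G → ℝ}
    (hf : ∀ x ∈ O, MDifferentiableAt 𝓘(ℝ, E) 𝓘(ℝ, ℝ) f x) (h0 : ∀ x ∈ O, ∀ u : E, invDeriv f x u = 0)
    {x₀ : G} (hx₀ : x₀ ∈ O) : ∀ᶠ x in 𝓝 x₀, f x = f x₀ := by
  set e := extChartAt 𝓘(ℝ, E) x₀ with he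
  have hopen : IsOpen (e.target ∩ e.symm ⁻¹' O) :=
    (continuousOn_extChartAt_symm x₀).isOpen_inter_preimage (isOpen_extChartAt_target x₀) hO
  have hxe : e.symm (e x₀) = x₀ := e.left_inv (mem_extChartAt_source x₀)
  obtain ⟨ε, hε, hball⟩ := Metric.isOpen_iff.1 hopen (e x₀)
    ⟨mem_extChartAt_target x₀, by rw [mem_preimage, hxe]; exact hx₀⟩
  have hd : ∀ y ∈ Metric.ball (e x₀) ε, DifferentiableAt ℝ (f ∘ e.symm) y := fun y hy => by
    rw [← mdifferentiableAt_iff_differentiableAt]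
    exact (hf _ (hball hy).2).comp y
      ((contMDiffAt_extChartAt_symm x₀ (hball hy).1).mdifferentiableAt (by simp))
  have hz : EqOn (fderiv ℝ (f ∘ e.symm)) 0 (Metric.ball (e x₀) ε) := fun y hy => by
    refine ContinuousLinearMap.ext fun z => ?_
    obtain ⟨φ, hφ⟩ := isInvertible_chartFrame x₀ (hball hy).1
    have h1 := fderiv_comp_extChartAt_symm x₀ (hball hy).1 (hf _ (hball hy).2) (φ.symm z)
    rw [h0 _ (hball hy).2, ← hφ] at h1
    rw [ContinuousLinearEquiv.coe_coe, ContinuousLinearEquiv.apply_symm_apply] at h1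
    exact h1
  obtain ⟨a, ha⟩ := Metric.isOpen_ball.exists_is_const_of_fderiv_eq_zero
    (convex_ball (e x₀) ε).isPreconnected (fun y hy => (hd y hy).differentiableWithinAt) hz
  filter_upwards [extChartAt_source_mem_nhds (I := 𝓘(ℝ, E)) x₀,
    (continuousAt_extChartAt (I := 𝓘(ℝ, E)) x₀).preimage_mem_nhds (Metric.ball_mem_nhds _ hε)]
    with x hx1 hx2
  have h1 := ha (e x) hx2
  have h2 := ha (e x₀) (Metric.mem_ball_self hε)
  simp only [Function.comp_apply, hxe] at h1 h2
  rw [e.left_inv hx1] at h1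
  rw [h1, h2]

theorem eq_of_invDeriv_eq [ConnectedSpace G] {f g : G → ℝ} (hf : MDifferentiable 𝓘(ℝ, E) 𝓘(ℝ, ℝ) f)
    (hg : MDifferentiable 𝓘(ℝ, E) 𝓘(ℝ, ℝ) g) (h : ∀ (x : G) (u : E), invDeriv f x u = invDeriv g x u)
    {x₀ : G} (h₀ : f x₀ = g x₀) : f = g := by
  have hloc : IsLocallyConstant (fun x => f x - g x) := by
    rw [IsLocallyConstant.iff_eventually_eq]
    exact fun x => eventually_eq_of_invDeriv_eq_zero (E := E) isOpen_univ
      (f := fun x => f x - g x) (fun x _ => (hf x).sub (hg x)) (fun x _ u => by rw [invDeriv_sub (hf x) (hg x), h, sub_self])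
      (mem_univ x)
  funext x
  have := hloc.apply_eq_of_preconnectedSpace x x₀
  simp only [h₀] at this
  linarith

/-- On a simply connected Lie group, a `1`-form which has local primitives has a primitive. -/
theorem exists_global_primitive [SimplyConnectedSpace G] [LocallyPathConnectedSpace G]
    (α : G → E → ℝ)
    (hα : ∀ x₀ : G, ∃ (O : Set G) (F : G → ℝ), IsOpen O ∧ x₀ ∈ O ∧
      ContMDiffOn 𝓘(ℝ, E) 𝓘(ℝ, ℝ) ∞ F O ∧ ∀ x ∈ O, ∀ u, invDeriv F x u = α x u) :
    ∃ F : G → ℝ, ContMDiff 𝓘(ℝ, E) 𝓘(ℝ, ℝ) ∞ F ∧ F 1 = 0 ∧ ∀ x u, invDeriv F x u = α x u := by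
  choose O F hO hxO hF hFα using hα
  have hFat : ∀ i, ∀ x ∈ O i, ContMDiffAt 𝓘(ℝ, E) 𝓘(ℝ, ℝ) ∞ (F i) x := fun i x hx =>
    (hF i).contMDiffAt ((hO i).mem_nhds hx)
  have hFd : ∀ i, ∀ x ∈ O i, MDifferentiableAt 𝓘(ℝ, E) 𝓘(ℝ, ℝ) (F i) x := fun i x hx =>
    (hFat i x hx).mdifferentiableAt (by simp)
  -- The covering space of germs of primitives: coordinate `v` at index `i` stands for the germ of
  -- `F i + v`. The transition is continuous for the discrete topology because two local primitives
  -- differ by a locally constant function.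
  let Z : FiberBundleCore G G DiscreteReal :=
    { baseSet := O
      isOpen_baseSet := hO
      indexAt := id
      mem_baseSet_at := hxO
      coordChange i j x v := v.shift (F i x - F j x)
      coordChange_self i x _ v := by
        rw [sub_self, DiscreteReal.shift_zero]
      continuousOn_coordChange i j := by
        rintro ⟨x₀, v₀⟩ ⟨hx, -⟩
        have hev := eventually_eq_of_invDeriv_eq_zero (E := E) ((hO i).inter (hO j))
          (f := fun x => F i x - F j x)
          (fun x hx => (hFd i x hx.1).sub (hFd j x hx.2)) (fun x hx u => by
            rw [invDeriv_sub (hFd i x hx.1) (hFd j x hx.2), hFα i x hx.1, hFα j x hx.2, sub_self]) hx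
        refine ContinuousAt.continuousWithinAt ?_
        refine (continuousAt_const (y := v₀.shift (F i x₀ - F j x₀))).congr ?_
        have h2 : ∀ᶠ p : G × DiscreteReal in 𝓝 (x₀, v₀), p.2 = v₀ :=
          continuousAt_snd.eventually (p := fun y : DiscreteReal => y = v₀) (by
            rw [nhds_discrete]; exact Filter.eventually_pure.2 rfl)
        have h1 : ∀ᶠ p : G × DiscreteReal in 𝓝 (x₀, v₀), F i p.1 - F j p.1 = F i x₀ - F j x₀ :=
          continuousAt_fst.eventually hev
        filter_upwards [h1, h2] with p hp1 hp2
        simp only [hp1, hp2]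
      coordChange_comp i j k x _ v := by
        rw [DiscreteReal.shift_shift]
        congr 1
        ring }
  have cov : IsCoveringMap (Bundle.TotalSpace.proj : Z.TotalSpace → G) :=
    FiberBundle.isCoveringMap (F := DiscreteReal) (E := Z.Fiber)
  -- Since `G` is simply connected, the identity lifts to a continuous section, that is, a coherent
  -- choice of germs.
  obtain ⟨s, ⟨-, hs⟩, -⟩ := cov.existsUnique_continuousMap_lifts (ContinuousMap.id G) 1
    (⟨1, (0 : ℝ)⟩ : Z.TotalSpace) rfl
  have hs' : ∀ x, (s x).proj = x := fun x => congrFun hs x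
  let val : Z.TotalSpace → ℝ := fun p => p.2
  let Φ : G → ℝ := fun x => val (s x) + F (s x).proj x
  -- `Φ x` is the value at `x` of the germ `s x`. Read at index `x₀`, the section has a coordinate
  -- in a discrete space, hence locally constant, so near `x₀` the function `Φ` is `F x₀` plus a
  -- constant.
  have hΦ : ∀ x₀, ∃ c : ℝ, ∀ᶠ x in 𝓝 x₀, Φ x = F x₀ x + c := by
    intro x₀
    have hcont : ContinuousAt (fun x => ((Z.localTriv x₀) (s x)).2) x₀ := by
      have h1 : ContinuousAt (Z.localTriv x₀) (s x₀) := by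
        refine (Z.localTriv x₀).toOpenPartialHomeomorph.continuousAt ?_
        change s x₀ ∈ (Z.localTriv x₀).source
        rw [(Z.localTriv x₀).mem_source]
        change (s x₀).proj ∈ O x₀
        rw [hs']
        exact hxO x₀
      exact continuousAt_snd.comp (ContinuousAt.comp (f := s) h1 s.continuous.continuousAt)
    have hev := hcont.eventually (p := fun y => y = ((Z.localTriv x₀) (s x₀)).2) (by
      rw [nhds_discrete]; exact Filter.eventually_pure.2 rfl)
    refine ⟨((Z.localTriv x₀) (s x₀)).2, hev.mono fun x hx => ?_⟩
    have h1 : (((Z.localTriv x₀) (s x)).2 : ℝ) = val (s x) + (F (s x).proj (s x).proj - F x₀ (s x).proj) := rfl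
    change val (s x) + F (s x).proj x = _
    rw [← hx, h1, hs']
    ring
  have hΦs : ContMDiff 𝓘(ℝ, E) 𝓘(ℝ, ℝ) ∞ Φ := fun x₀ => by
    obtain ⟨c, hc⟩ := hΦ x₀
    exact ((hFat x₀ x₀ (hxO x₀)).add contMDiffAt_const).congr_of_eventuallyEq hc
  have hΦd : MDifferentiable 𝓘(ℝ, E) 𝓘(ℝ, ℝ) Φ := hΦs.mdifferentiable (by simp)
  have hc0 : ∀ (c : ℝ) (x : G) (u : E), invDeriv (fun _ : G => c) x u = 0 := fun c x u => by
    simp only [invDeriv, mfderiv_const]; rfl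
  refine ⟨fun x => Φ x - Φ 1, hΦs.sub contMDiff_const, sub_self _, fun x u => ?_⟩
  obtain ⟨c, hc⟩ := hΦ x
  rw [invDeriv_sub (hΦd x) mdifferentiableAt_const, hc0, sub_zero, ← hFα x x (hxO x)]
  have h1 : invDeriv (fun y => Φ y - F x y) x u = invDeriv (fun _ => c) x u := by
    have : (fun y => Φ y - F x y) =ᶠ[𝓝 x] fun _ => c := hc.mono fun y hy => by simp only [hy]; ring
    simp only [invDeriv, this.mfderiv_eq]
    rfl
  rw [invDeriv_sub (hΦd x) (hFd x x (hxO x)), hc0] at h1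
  linarith

end GlobalPrimitives

/-! ### Homomorphisms that are local homeomorphisms at the identity -/

section Covering

open Set Filter

/-- A homomorphism from a connected group to a simply connected one, which is a local homeomorphism
at the identity, is bijective and open. -/
theorem bijective_of_map_nhds_one {G M : Type*} [TopologicalSpace G] [Group G] [IsTopologicalGroup G]
    [ConnectedSpace G] [TopologicalSpace M] [Group M] [IsTopologicalGroup M] [SimplyConnectedSpace M]
    [LocallyPathConnectedSpace M] (φ : G →* M) (hφ : Continuous φ) (hmap : map φ (𝓝 1) = 𝓝 1)
    (hinj : ∃ U ∈ 𝓝 (1 : G), ∀ x ∈ U, φ x = 1 → x = 1) : Function.Bijective φ ∧ IsOpenMap φ := by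
  have hopen : IsOpenMap φ := IsTopologicalGroup.isOpenMap_iff_nhds_one.2 hmap.ge
  have hsurj : Function.Surjective φ := by
    -- The image is an open subgroup, hence closed, and the target is connected.
    have hr : IsOpen (φ.range : Set M) := by
      rw [MonoidHom.coe_range]; exact hopen.isOpen_range
    have hcl : IsClopen (φ.range : Set M) := ⟨φ.range.isClosed_of_isOpen hr, hr⟩
    have := hcl.eq_univ ⟨1, φ.range.one_mem⟩
    rw [MonoidHom.coe_range] at this
    exact range_eq_univ.1 this
  have hdisc : IsDiscrete (φ.ker : Set G) := by
    obtain ⟨U, hU, hU1⟩ := hinj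
    rw [isDiscrete_iff_nhdsWithin]
    intro x hx
    refine le_antisymm ?_ (pure_le_nhdsWithin hx)
    rw [le_pure_iff, mem_nhdsWithin_iff_exists_mem_nhds_inter]
    refine ⟨(fun y => x⁻¹ * y) ⁻¹' U, (continuous_const_mul x⁻¹).continuousAt.preimage_mem_nhds
      (by simpa using hU), fun y ⟨hy, hyk⟩ => ?_⟩
    have h1 := hU1 _ hy (by
      rw [map_mul, map_inv, MonoidHom.mem_ker.1 hx, MonoidHom.mem_ker.1 hyk]; simp)
    rw [mem_singleton_iff]
    exact (inv_mul_eq_one.1 h1).symm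
  have cov : IsCoveringMap φ :=
    ((hopen.isQuotientMap hφ hsurj).isQuotientCoveringMap_of_isDiscrete_ker_monoidHom hdisc).isCoveringMap
  obtain ⟨s, ⟨hs1, hs⟩, -⟩ := cov.existsUnique_continuousMap_lifts (ContinuousMap.id M) 1 1 (by simp)
  -- Both `s ∘ φ` and `id` lift `φ` through the covering `φ` itself and agree at `1`, so they
  -- coincide on the connected group `G`.
  have hsφ : s ∘ φ = id := cov.eq_of_comp_eq (s.continuous.comp hφ) continuous_id
    (by rw [← Function.comp_assoc, hs]; rfl) 1 (by simpa using hs1)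
  exact ⟨⟨Function.LeftInverse.injective (g := s) (congrFun hsφ), hsurj⟩, hopen⟩

end Covering

/-! ### The inverse function theorem on a manifold -/

section InverseFunction

open Set Filter

variable {E F : Type*} [NormedAddCommGroup E] [NormedSpace ℝ E]
  [NormedAddCommGroup F] [NormedSpace ℝ F]
  {G : Type*} [TopologicalSpace G] [ChartedSpace E G] [IsManifold 𝓘(ℝ, E) ∞ G]

theorem exists_hasFDerivAt_comp_extChartAt_symm {φ : G → F} {x : G}
    (hφ : ContMDiffAt 𝓘(ℝ, E) 𝓘(ℝ, F) ∞ φ x)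
    (hd : (mfderiv 𝓘(ℝ, E) 𝓘(ℝ, F) φ x : E →L[ℝ] F).IsInvertible) :
    ContDiffAt ℝ ∞ (φ ∘ (extChartAt 𝓘(ℝ, E) x).symm) (extChartAt 𝓘(ℝ, E) x x) ∧
    ∃ L : E ≃L[ℝ] F, HasFDerivAt (φ ∘ (extChartAt 𝓘(ℝ, E) x).symm) (L : E →L[ℝ] F)
      (extChartAt 𝓘(ℝ, E) x x) := by
  have : IsManifold 𝓘(ℝ, E) 1 G := .of_le (n := ∞) (by simp)
  have hx : (extChartAt 𝓘(ℝ, E) x).symm (extChartAt 𝓘(ℝ, E) x x) = x := extChartAt_to_inv x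
  have hs : ContMDiffAt 𝓘(ℝ, E) 𝓘(ℝ, E) ∞ (extChartAt 𝓘(ℝ, E) x).symm (extChartAt 𝓘(ℝ, E) x x) :=
    (contMDiffOn_extChartAt_symm x).contMDiffAt
      ((isOpen_extChartAt_target x).mem_nhds (mem_extChartAt_target x))
  have hc : ContMDiffAt 𝓘(ℝ, E) 𝓘(ℝ, F) ∞ (φ ∘ (extChartAt 𝓘(ℝ, E) x).symm)
      (extChartAt 𝓘(ℝ, E) x x) := ContMDiffAt.comp _ (by rwa [hx]) hs
  refine ⟨contMDiffAt_iff_contDiffAt.1 hc, ?_⟩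
  have hi : (mfderiv 𝓘(ℝ, E) 𝓘(ℝ, E) (extChartAt 𝓘(ℝ, E) x).symm
      (extChartAt 𝓘(ℝ, E) x x) : E →L[ℝ] E).IsInvertible := by
    have h := isInvertible_mfderivWithin_extChartAt_symm (I := 𝓘(ℝ, E)) (mem_extChartAt_target x)
    rwa [ModelWithCorners.Boundaryless.range_eq_univ, mfderivWithin_univ] at h
  have hd' : (mfderiv 𝓘(ℝ, E) 𝓘(ℝ, F) φ ((extChartAt 𝓘(ℝ, E) x).symm (extChartAt 𝓘(ℝ, E) x x)) :
      E →L[ℝ] F).IsInvertible := by rwa [hx]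
  obtain ⟨L, hL⟩ := hd'.comp hi
  have h := mfderiv_comp (I' := 𝓘(ℝ, E)) (extChartAt 𝓘(ℝ, E) x x)
    (((by rwa [hx] : ContMDiffAt 𝓘(ℝ, E) 𝓘(ℝ, F) ∞ φ
      ((extChartAt 𝓘(ℝ, E) x).symm (extChartAt 𝓘(ℝ, E) x x)))).mdifferentiableAt (by simp))
    (hs.mdifferentiableAt (by simp))
  rw [mfderiv_eq_fderiv] at h
  have h' : fderiv ℝ (φ ∘ (extChartAt 𝓘(ℝ, E) x).symm) (extChartAt 𝓘(ℝ, E) x x) =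
    ((show E ≃L[ℝ] F from L) : E →L[ℝ] F) := h.trans hL.symm
  exact ⟨L, h' ▸ ((contMDiffAt_iff_contDiffAt.1 hc).differentiableAt (by simp)).hasFDerivAt⟩

variable [CompleteSpace E]

theorem map_nhds_eq_of_isInvertible_mfderiv {φ : G → F} {x : G}
    (hφ : ContMDiffAt 𝓘(ℝ, E) 𝓘(ℝ, F) ∞ φ x)
    (hd : (mfderiv 𝓘(ℝ, E) 𝓘(ℝ, F) φ x : E →L[ℝ] F).IsInvertible) :
    map φ (𝓝 x) = 𝓝 (φ x) ∧ ∃ U ∈ 𝓝 x, InjOn φ U := by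
  obtain ⟨hc, L, hL⟩ := exists_hasFDerivAt_comp_extChartAt_symm hφ hd
  have hst := hc.hasStrictFDerivAt' hL (by simp)
  set e := extChartAt 𝓘(ℝ, E) x with he
  have hev : (φ ∘ e.symm) ∘ e =ᶠ[𝓝 x] φ :=
    eventually_of_mem (extChartAt_source_mem_nhds (I := 𝓘(ℝ, E)) x) fun y hy => by
      simp only [Function.comp_apply, e.left_inv hy]
  have hx : e.symm (e x) = x := extChartAt_to_inv x
  constructor
  · rw [← map_congr hev, ← map_map, map_extChartAt_nhds_of_boundaryless, hst.map_nhds_eq_of_equiv,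
      Function.comp_apply, hx]
  · let T := hst.toOpenPartialHomeomorph (φ ∘ e.symm)
    refine ⟨e.source ∩ e ⁻¹' T.source, inter_mem (extChartAt_source_mem_nhds x)
      ((continuousAt_extChartAt x).preimage_mem_nhds
        (T.open_source.mem_nhds hst.mem_toOpenPartialHomeomorph_source)), fun y hy z hz hyz => ?_⟩
    refine e.injOn hy.1 hz.1 (T.injOn hy.2 hz.2 ?_)
    change φ (e.symm (e y)) = φ (e.symm (e z))
    rw [e.left_inv hy.1, e.left_inv hz.1, hyz]

theorem contMDiff_symm_of_isInvertible_mfderiv (φ : G ≃ₜ F) (hφ : ContMDiff 𝓘(ℝ, E) 𝓘(ℝ, F) ∞ φ)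
    (hd : ∀ x, (mfderiv 𝓘(ℝ, E) 𝓘(ℝ, F) φ x : E →L[ℝ] F).IsInvertible) :
    ContMDiff 𝓘(ℝ, F) 𝓘(ℝ, E) ∞ φ.symm := by
  intro y
  obtain ⟨x, rfl⟩ := φ.surjective y
  obtain ⟨hc, L, hL⟩ := exists_hasFDerivAt_comp_extChartAt_symm (hφ x) (hd x)
  let T : OpenPartialHomeomorph E F := (chartAt E x).symm.trans φ.toOpenPartialHomeomorph
  have hT : (T : E → F) = φ ∘ (extChartAt 𝓘(ℝ, E) x).symm := rfl
  have hTs : (T.symm : F → E) = extChartAt 𝓘(ℝ, E) x ∘ φ.symm := rfl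
  have hx : T.symm (φ x) = extChartAt 𝓘(ℝ, E) x x := by rw [hTs]; simp
  have hmem : φ x ∈ T.target := by simp [T]
  have h1 : ContDiffAt ℝ ∞ T.symm (φ x) :=
    T.contDiffAt_symm (f₀' := L) hmem (by rw [hx, hT]; exact hL) (by rw [hx, hT]; exact hc)
  have h2 : ContMDiffAt 𝓘(ℝ, F) 𝓘(ℝ, E) ∞ ((extChartAt 𝓘(ℝ, E) x).symm ∘ T.symm) (φ x) :=
    ContMDiffAt.comp _ (by
      rw [hx]
      exact (contMDiffOn_extChartAt_symm x).contMDiffAt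
        ((isOpen_extChartAt_target x).mem_nhds (mem_extChartAt_target x))) h1.contMDiffAt
  refine h2.congr_of_eventuallyEq ?_
  have hn : φ.symm ⁻¹' (extChartAt 𝓘(ℝ, E) x).source ∈ 𝓝 (φ x) :=
    φ.symm.continuous.continuousAt.preimage_mem_nhds (by
      rw [φ.symm_apply_apply]; exact extChartAt_source_mem_nhds x)
  filter_upwards [hn] with z hz
  rw [hTs]
  exact ((extChartAt 𝓘(ℝ, E) x).left_inv hz).symm

end InverseFunction

/-! ### Coordinate functions on the group -/

section Coordinates

variable {E : Type*} [NormedAddCommGroup E] [NormedSpace ℝ E]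
  {F F' : Type*} [NormedAddCommGroup F] [NormedSpace ℝ F] [NormedAddCommGroup F'] [NormedSpace ℝ F']
  {G : Type*} [TopologicalSpace G] [ChartedSpace E G] [Group G]

theorem invDeriv_comp {g : F → F'} {f : G → F} {x : G} {g' : F →L[ℝ] F'}
    (hg : HasFDerivAt g g' (f x)) (hf : MDifferentiableAt 𝓘(ℝ, E) 𝓘(ℝ, F) f x) (u : E) :
    invDeriv (fun y => g (f y)) x u = g' (invDeriv f x u) := by
  have h := (hg.hasMFDerivAt.comp x hf.hasMFDerivAt).mfderiv
  exact congrArg (fun T : E →L[ℝ] F' =>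
    T (mulInvariantVectorField (I := 𝓘(ℝ, E)) (u : GroupLieAlgebra 𝓘(ℝ, E) G) x)) h

/-- A vector-valued function with smooth coordinates is smooth, and is differentiated coordinatewise. -/
theorem contMDiff_toLp_and_invDeriv {m : ℕ} (f : Fin m → G → ℝ)
    (hf : ∀ j, ContMDiff 𝓘(ℝ, E) 𝓘(ℝ, ℝ) ∞ (f j)) :
    ContMDiff 𝓘(ℝ, E) 𝓘(ℝ, EuclideanSpace ℝ (Fin m)) ∞ (fun x => WithLp.toLp 2 fun j => f j x) ∧
    ∀ x (u : E), invDeriv (fun x => (WithLp.toLp 2 fun j => f j x : EuclideanSpace ℝ (Fin m))) x u =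
      WithLp.toLp 2 fun j => invDeriv (f j) x u := by
  have h1 : ContMDiff 𝓘(ℝ, E) 𝓘(ℝ, EuclideanSpace ℝ (Fin m)) ∞
      (fun x => WithLp.toLp 2 fun j => f j x) :=
    (EuclideanSpace.equiv (Fin m) ℝ).symm.contDiff.contMDiff.comp (contMDiff_pi_space.2 hf)
  refine ⟨h1, fun x u => PiLp.ext fun j => ?_⟩
  exact (invDeriv_comp (EuclideanSpace.proj (𝕜 := ℝ) j).hasFDerivAt
    (h1.mdifferentiableAt (by simp)) u).symm

variable [LieGroup 𝓘(ℝ, E) ∞ G]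

theorem mulInvariantVectorField_mul (u : E) (g x : G) :
    (mulInvariantVectorField (I := 𝓘(ℝ, E)) (u : GroupLieAlgebra 𝓘(ℝ, E) G) (g * x) : E) =
    mfderiv 𝓘(ℝ, E) 𝓘(ℝ, E) (fun y : G => g * y) x
      (mulInvariantVectorField (I := 𝓘(ℝ, E)) (u : GroupLieAlgebra 𝓘(ℝ, E) G) x) := by
  have d : ∀ g x : G, MDifferentiableAt 𝓘(ℝ, E) 𝓘(ℝ, E) (fun y : G => g * y) x := fun g x =>
    (contMDiff_mul_left (I := 𝓘(ℝ, E)) (n := ∞)).mdifferentiableAt (by simp)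
  have h := mfderiv_comp (I' := 𝓘(ℝ, E)) (1 : G) (d g (x * 1)) (d x 1)
  have h1 : (fun y : G => g * y) ∘ (fun y : G => x * y) = fun y => g * x * y := by
    funext y; simp [mul_assoc]
  rw [h1] at h
  have h2 := congrArg (fun T : E →L[ℝ] E => T u) h
  have h3 : ∀ z : G, z = x → ∀ v : E, (mfderiv 𝓘(ℝ, E) 𝓘(ℝ, E) (fun y : G => g * y) z : E →L[ℝ] E) v =
    (mfderiv 𝓘(ℝ, E) 𝓘(ℝ, E) (fun y : G => g * y) x : E →L[ℝ] E) v := by rintro z rfl v; rfl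
  exact h2.trans (h3 _ (mul_one x) _)

/-- Left-invariant fields are preserved by left translations. This is what turns uniqueness of
primitives into multiplication formulas. -/
theorem invDeriv_comp_mul_left {f : G → F} {g x : G}
    (hf : MDifferentiableAt 𝓘(ℝ, E) 𝓘(ℝ, F) f (g * x)) (u : E) :
    invDeriv (fun y => f (g * y)) x u = invDeriv f (g * x) u := by
  have d : MDifferentiableAt 𝓘(ℝ, E) 𝓘(ℝ, E) (fun y : G => g * y) x :=
    (contMDiff_mul_left (I := 𝓘(ℝ, E)) (n := ∞)).mdifferentiableAt (by simp)
  have h := mfderiv_comp (I' := 𝓘(ℝ, E)) x hf d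
  have h2 := congrArg (fun T : E →L[ℝ] F =>
    T (mulInvariantVectorField (I := 𝓘(ℝ, E)) (u : GroupLieAlgebra 𝓘(ℝ, E) G) x)) h
  refine h2.trans ?_
  exact congrArg (mfderiv 𝓘(ℝ, E) 𝓘(ℝ, F) f (g * x) : E →L[ℝ] F)
    (mulInvariantVectorField_mul u g x).symm

theorem hasFDerivAt_exp_weight {q p : ℕ} (Ω : Matrix (Fin q) (Fin p) ℝ) (i : Fin p)
    (s : EuclideanSpace ℝ (Fin q)) :
    HasFDerivAt (fun s => Real.exp (CyclicModel.weight Ω s i))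
      (Real.exp (CyclicModel.weight Ω s i) • innerSL ℝ (WithLp.toLp 2 (Ω.col i))) s := by
  have h : (fun s => CyclicModel.weight Ω s i) = innerSL ℝ (WithLp.toLp 2 (Ω.col i)) := by
    funext s
    exact real_inner_comm _ _
  have h2 : HasFDerivAt (fun s => CyclicModel.weight Ω s i) (innerSL ℝ (WithLp.toLp 2 (Ω.col i))) s := by
    rw [h]; exact ContinuousLinearMap.hasFDerivAt _
  exact h2.exp

variable [FiniteDimensional ℝ E] [CompleteSpace E] [SimplyConnectedSpace G]
  [LocallyPathConnectedSpace G]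

theorem exists_primitive (w : G → ℝ) (hw : ContMDiff 𝓘(ℝ, E) 𝓘(ℝ, ℝ) ∞ w) (l : E →L[ℝ] ℝ)
    (hcl : ∀ (x : G) (u v : E),
      invDeriv w x u * l v - invDeriv w x v * l u = w x * l (modelBracket G u v)) :
    ∃ F : G → ℝ, ContMDiff 𝓘(ℝ, E) 𝓘(ℝ, ℝ) ∞ F ∧ F 1 = 0 ∧ ∀ x u, invDeriv F x u = w x * l u :=
  exists_global_primitive _ fun x₀ => exists_local_primitive w hw l hcl x₀

/-- A functional that kills brackets defines a closed left-invariant form. If `f j` is its primitive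
vanishing at `1`, then `y ↦ f j (g * y)` and `y ↦ f j g + f j y` have the same derivatives and agree
at `1`. -/
theorem exists_additive_coordinates {m : ℕ} (l : Fin m → E →L[ℝ] ℝ)
    (hl : ∀ j u v, l j (modelBracket G u v) = 0) :
    ∃ f : G → EuclideanSpace ℝ (Fin m), ContMDiff 𝓘(ℝ, E) 𝓘(ℝ, EuclideanSpace ℝ (Fin m)) ∞ f ∧
      (∀ g x, f (g * x) = f g + f x) ∧ ∀ x u, invDeriv f x u = WithLp.toLp 2 fun j => l j u := by
  have hc : ∀ (c : ℝ) (x : G) (u : E), invDeriv (fun _ : G => c) x u = 0 := fun c x u => by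
    simp only [invDeriv, mfderiv_const]; rfl
  have h := fun j => exists_primitive (fun _ : G => (1 : ℝ)) contMDiff_const (l j)
    (fun x u v => by rw [hc, hc, hl]; simp)
  choose f hf hf1 hfd using h
  obtain ⟨h1, h2⟩ := contMDiff_toLp_and_invDeriv f hf
  refine ⟨_, h1, fun g x => PiLp.ext fun j => ?_, fun x u => by rw [h2]; simp only [hfd, one_mul]⟩
  have hd : MDifferentiable 𝓘(ℝ, E) 𝓘(ℝ, ℝ) (f j) := (hf j).mdifferentiable (by simp)
  have hmul : MDifferentiable 𝓘(ℝ, E) 𝓘(ℝ, E) (fun y : G => g * y) :=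
    (contMDiff_mul_left (I := 𝓘(ℝ, E)) (n := ∞)).mdifferentiable (by simp)
  have key : (fun y => f j (g * y)) = fun y => f j g + f j y := by
    refine eq_of_invDeriv_eq (E := E) (hd.comp hmul) (mdifferentiable_const.add hd) (fun y u => ?_)
      (x₀ := 1) (by simp [hf1])
    have h3 := invDeriv_comp (g := fun z => f j g + z) ((hasFDerivAt_id (f j y)).const_add _) (hd y) u
    rw [invDeriv_comp_mul_left (hd _), hfd]
    exact (hfd j y u).symm.trans h3.symm
  exact congrFun key x

/-- The coordinate functions `(s, t)` identifying the group with a model group. -/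
theorem exists_twisted_coordinates {q p : ℕ} (Ω : Matrix (Fin q) (Fin p) ℝ)
    (la : Fin q → E →L[ℝ] ℝ) (le : Fin p → E →L[ℝ] ℝ)
    (hle : ∀ i u v, le i (modelBracket G u v) = ∑ j, Ω j i * (la j u * le i v - la j v * le i u))
    {s : G → EuclideanSpace ℝ (Fin q)} (hs : ContMDiff 𝓘(ℝ, E) 𝓘(ℝ, EuclideanSpace ℝ (Fin q)) ∞ s)
    (hsm : ∀ g x, s (g * x) = s g + s x)
    (hsd : ∀ x u, invDeriv s x u = WithLp.toLp 2 fun j => la j u) :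
    ∃ t : G → EuclideanSpace ℝ (Fin p), ContMDiff 𝓘(ℝ, E) 𝓘(ℝ, EuclideanSpace ℝ (Fin p)) ∞ t ∧
      (∀ g x, t (g * x) = WithLp.toLp 2 fun i => t g i + Real.exp (CyclicModel.weight Ω (s g) i) * t x i) ∧
      ∀ x u, invDeriv t x u =
        WithLp.toLp 2 fun i => Real.exp (CyclicModel.weight Ω (s x) i) * le i u := by
  have hw : ∀ i, ContMDiff 𝓘(ℝ, E) 𝓘(ℝ, ℝ) ∞ (fun x : G => Real.exp (CyclicModel.weight Ω (s x) i)) :=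
    fun i => (CyclicModel.contDiff_weight Ω i).exp.contMDiff.comp hs
  have hwd : ∀ i (x : G) (u : E), invDeriv (fun x : G => Real.exp (CyclicModel.weight Ω (s x) i)) x u =
      Real.exp (CyclicModel.weight Ω (s x) i) * ∑ j, Ω j i * la j u := fun i x u => by
    rw [invDeriv_comp (hasFDerivAt_exp_weight Ω i (s x)) (hs.mdifferentiableAt (by simp)), hsd]
    simp [PiLp.inner_apply, mul_comm]
  -- With `w = e^{⟨s,Ω_i⟩}` one has `dw = w ∑ Ω_ji la_j`, so by the bracket formula `hle` the form
  -- `w · le_i` is closed.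
  have h := fun i => exists_primitive (fun x : G => Real.exp (CyclicModel.weight Ω (s x) i)) (hw i) (le i)
    (fun x u v => by
      rw [hwd, hwd, hle, mul_assoc, mul_assoc, ← mul_sub, Finset.sum_mul, Finset.sum_mul,
        ← Finset.sum_sub_distrib]
      congr 1
      refine Finset.sum_congr rfl fun j _ => ?_
      ring)
  choose f hf hf1 hfd using h
  obtain ⟨h1, h2⟩ := contMDiff_toLp_and_invDeriv f hf
  refine ⟨_, h1, fun g x => PiLp.ext fun i => ?_, fun x u => by rw [h2]; simp only [hfd]⟩
  have hd : MDifferentiable 𝓘(ℝ, E) 𝓘(ℝ, ℝ) (f i) := (hf i).mdifferentiable (by simp)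
  have hmul : MDifferentiable 𝓘(ℝ, E) 𝓘(ℝ, E) (fun y : G => g * y) :=
    (contMDiff_mul_left (I := 𝓘(ℝ, E)) (n := ∞)).mdifferentiable (by simp)
  set c := Real.exp (CyclicModel.weight Ω (s g) i) with hcdef
  -- Translating by `g` multiplies `e^{⟨s,Ω_i⟩}` by the constant `c`, because `s` is additive; so
  -- both sides have the same derivatives, and they agree at `1`.
  have key : (fun y => f i (g * y)) = fun y => f i g + c * f i y := by
    have hder : ∀ z : ℝ, HasFDerivAt (fun z : ℝ => f i g + c * z) (c • ContinuousLinearMap.id ℝ ℝ) z :=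
      fun z => ((hasFDerivAt_id z).const_mul c).const_add _
    refine eq_of_invDeriv_eq (E := E) (hd.comp hmul)
      (fun y => ((hder (f i y)).differentiableAt.mdifferentiableAt.comp y (hd y)))
      (fun y u => ?_) (x₀ := 1) (by simp [hf1])
    rw [invDeriv_comp_mul_left (hd _), hfd, invDeriv_comp (hder _) (hd y), hfd, hsm,
      CyclicModel.weight_add, Real.exp_add]
    simp [hcdef, mul_assoc]
  exact congrFun key x

end Coordinates

/-! ### Topology of the model groups -/

section Models

instance {q p : ℕ} (Ω : Matrix (Fin q) (Fin p) ℝ) : IsTopologicalGroup (CyclicModel Ω) :=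
  topologicalGroup_of_lieGroup 𝓘(ℝ, Space q p) ∞

instance (r : ℕ) : IsTopologicalGroup (EuclideanGroup r) :=
  topologicalGroup_of_lieGroup (𝓡 r) ∞

instance {q p : ℕ} (Ω : Matrix (Fin q) (Fin p) ℝ) (r : ℕ) :
    SimplyConnectedSpace (CyclicModel Ω × EuclideanGroup r) := by
  have : ContractibleSpace (Space q p × EuclideanSpace ℝ (Fin r)) :=
    RealTopologicalVectorSpace.contractibleSpace
  exact (inferInstance : SimplyConnectedSpace (Space q p × EuclideanSpace ℝ (Fin r)))

instance {q p : ℕ} (Ω : Matrix (Fin q) (Fin p) ℝ) (r : ℕ) :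
    LocallyPathConnectedSpace (CyclicModel Ω × EuclideanGroup r) :=
  inferInstanceAs (LocallyPathConnectedSpace (Space q p × EuclideanSpace ℝ (Fin r)))

/-- If `q = 0` all weights vanish, and if `p = 0` there is nothing to twist. This forces `q, p ≥ 1`
when `G` is not abelian. -/
theorem CyclicModel.mul_comm_of_eq_zero {q p : ℕ} (Ω : Matrix (Fin q) (Fin p) ℝ) (h : q = 0 ∨ p = 0)
    (a b : CyclicModel Ω) : a * b = b * a := by
  refine Prod.ext (add_comm a.1 b.1) (PiLp.ext fun i => ?_)
  change a.2 i + Real.exp (weight Ω a.1 i) * b.2 i = b.2 i + Real.exp (weight Ω b.1 i) * a.2 i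
  rcases h with rfl | rfl
  · have h0 : ∀ s : EuclideanSpace ℝ (Fin 0), weight Ω s i = 0 := fun s => by
      simp [weight, PiLp.inner_apply]
    rw [h0, h0, Real.exp_zero]
    ring
  · exact i.elim0

end Models

/-! ### The isometry with the model -/

section Metric

variable {n : ℕ} {G : Type*} [TopologicalSpace G] [ChartedSpace (EuclideanSpace ℝ (Fin n)) G] [Group G]
  [LieGroup (𝓡 n) ∞ G]

/-- The scalar product on the Lie algebra. -/
noncomputable def algebraForm (h : RiemannianMetricOn (𝓡 n) G) : LinearMap.BilinForm ℝ (GroupLieAlgebra (𝓡 n) G) :=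
  LinearMap.mk₂ ℝ (fun u v => h.inner 1 u v) (fun _ _ _ => by simp) (fun _ _ _ => by simp)
    (fun _ _ _ => by simp) (fun _ _ _ => by simp)

theorem algebraForm_apply (h : RiemannianMetricOn (𝓡 n) G) (u v : GroupLieAlgebra (𝓡 n) G) :
    algebraForm h u v = h.inner 1 u v := rfl

theorem inner_mulInvariantVectorField {h : RiemannianMetricOn (𝓡 n) G} (hi : IsLeftInvariantMetric h)
    (x : G) (u v : GroupLieAlgebra (𝓡 n) G) :
    h.inner x (mulInvariantVectorField u x) (mulInvariantVectorField v x) = h.inner 1 u v := by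
  rw [← hi x 1 u v]
  have : ∀ y : G, y = x → ∀ a b : EuclideanSpace ℝ (Fin n),
      (h.inner x : EuclideanSpace ℝ (Fin n) →L[ℝ] EuclideanSpace ℝ (Fin n) →L[ℝ] ℝ) a b =
      (h.inner y : EuclideanSpace ℝ (Fin n) →L[ℝ] EuclideanSpace ℝ (Fin n) →L[ℝ] ℝ) a b := by
    rintro y rfl a b; rfl
  exact this _ (mul_one x) _ _

theorem exists_mulInvariantVectorField_eq (x : G) (v : TangentSpace (𝓡 n) x) :
    ∃ u : GroupLieAlgebra (𝓡 n) G, mulInvariantVectorField u x = v := by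
  obtain ⟨e, he⟩ := isInvertible_mfderiv_mul_left (E := EuclideanSpace ℝ (Fin n)) x (1 : G)
  have h1 : ∀ u, mulInvariantVectorField (I := 𝓡 n) u x = e u := fun u => by
    rw [mulInvariantVectorField, ← he]; rfl
  exact ⟨e.symm v, (h1 _).trans (e.apply_symm_apply v)⟩

theorem exists_isometry_model [ConnectedSpace G] [SimplyConnectedSpace G]
    (h : RiemannianMetricOn (𝓡 n) G) (hi : IsLeftInvariantMetric h)
    {q p r : ℕ} (Ω : Matrix (Fin q) (Fin p) ℝ)
    (b : Module.Basis (Fin q ⊕ Fin p ⊕ Fin r) ℝ (GroupLieAlgebra (𝓡 n) G))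
    (hb : ∀ i j, algebraForm h (b i) (b j) = if i = j then 1 else 0)
    (ha : ∀ (u v : GroupLieAlgebra (𝓡 n) G) j, algebraForm h (b (.inl j)) ⁅u, v⁆ = 0)
    (hc : ∀ (u v : GroupLieAlgebra (𝓡 n) G) k, algebraForm h (b (.inr (.inr k))) ⁅u, v⁆ = 0)
    (he : ∀ (u v : GroupLieAlgebra (𝓡 n) G) i, algebraForm h (b (.inr (.inl i))) ⁅u, v⁆ = ∑ j, Ω j i *
      (algebraForm h (b (.inl j)) u * algebraForm h (b (.inr (.inl i))) v -
        algebraForm h (b (.inl j)) v * algebraForm h (b (.inr (.inl i))) u)) :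
    ∃ φ : G ≃* CyclicModel Ω × EuclideanGroup r,
        ContMDiff (𝓡 n) (𝓘(ℝ, Space q p).prod (𝓡 r)) ∞ φ ∧
        ContMDiff (𝓘(ℝ, Space q p).prod (𝓡 r)) (𝓡 n) ∞ φ.symm ∧
        PreservesMetric h (prodMetric (CyclicModel.h0 Ω) (EuclideanGroup.flatMetric r)) φ := by
  have : LocallyPathConnectedSpace G :=
    ChartedSpace.locallyPathConnectedSpace (EuclideanSpace ℝ (Fin n)) G
  have : IsTopologicalGroup G := topologicalGroup_of_lieGroup (𝓡 n) ∞
  -- By orthonormality these functionals are the basis dual to `b`.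
  let l : (Fin q ⊕ Fin p ⊕ Fin r) → EuclideanSpace ℝ (Fin n) →L[ℝ] ℝ := fun i => h.inner 1 (b i)
  obtain ⟨s, hs, hsm, hsd⟩ := exists_additive_coordinates (G := G) (fun j => l (.inl j))
    (fun j u v => ha u v j)
  obtain ⟨c, hcs, hcm, hcd⟩ := exists_additive_coordinates (G := G) (fun k => l (.inr (.inr k)))
    (fun k u v => hc u v k)
  obtain ⟨t, ht, htm, htd⟩ := exists_twisted_coordinates Ω (fun j => l (.inl j))
    (fun i => l (.inr (.inl i))) (fun i u v => he u v i) hs hsm hsd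
  let φ₀ : G → Space q p × EuclideanSpace ℝ (Fin r) := fun x => ((s x, t x), c x)
  have hst : ContMDiff (𝓡 n) 𝓘(ℝ, Space q p) ∞ (fun x => ((s x, t x) : Space q p)) := hs.prodMk_space ht
  have hφ₀ : ContMDiff (𝓡 n) 𝓘(ℝ, Space q p × EuclideanSpace ℝ (Fin r)) ∞ φ₀ := hst.prodMk_space hcs
  have hstd : ∀ x (u : EuclideanSpace ℝ (Fin n)), invDeriv (fun x => ((s x, t x) : Space q p)) x u =
      (invDeriv s x u, invDeriv t x u) := fun x u => Prod.ext
    (invDeriv_comp (ContinuousLinearMap.fst ℝ _ _).hasFDerivAt (hst.mdifferentiableAt (by simp)) u).symm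
    (invDeriv_comp (ContinuousLinearMap.snd ℝ _ _).hasFDerivAt (hst.mdifferentiableAt (by simp)) u).symm
  have hφd : ∀ x (u : EuclideanSpace ℝ (Fin n)), invDeriv φ₀ x u =
      ((invDeriv s x u, invDeriv t x u), invDeriv c x u) := fun x u => Prod.ext
    ((invDeriv_comp (ContinuousLinearMap.fst ℝ _ _).hasFDerivAt
      (hφ₀.mdifferentiableAt (by simp)) u).symm.trans (hstd x u))
    (invDeriv_comp (ContinuousLinearMap.snd ℝ _ _).hasFDerivAt (hφ₀.mdifferentiableAt (by simp)) u).symm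
  have hφd' : ∀ x (u : EuclideanSpace ℝ (Fin n)), invDeriv φ₀ x u =
      ((WithLp.toLp 2 fun j => l (.inl j) u, WithLp.toLp 2 fun i =>
        Real.exp (CyclicModel.weight Ω (s x) i) * l (.inr (.inl i)) u),
        WithLp.toLp 2 fun k => l (.inr (.inr k)) u) := fun x u => by
    rw [hφd, hsd, htd, hcd]
  have hcard : n = q + (p + r) := by
    have h1 := Module.finrank_eq_card_basis b
    have h2 : Module.finrank ℝ (GroupLieAlgebra (𝓡 n) G) = n :=
      finrank_euclideanSpace_fin (𝕜 := ℝ) (n := n)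
    rw [h2] at h1
    simpa using h1
  have hexp := eq_sum_smul_of_orthonormal b hb
  have hinv : ∀ x, (mfderiv (𝓡 n) 𝓘(ℝ, Space q p × EuclideanSpace ℝ (Fin r)) φ₀ x :
      EuclideanSpace ℝ (Fin n) →L[ℝ] Space q p × EuclideanSpace ℝ (Fin r)).IsInvertible := by
    intro x
    set T : EuclideanSpace ℝ (Fin n) →L[ℝ] Space q p × EuclideanSpace ℝ (Fin r) :=
      mfderiv (𝓡 n) 𝓘(ℝ, Space q p × EuclideanSpace ℝ (Fin r)) φ₀ x
    -- Up to the nonzero factors `e^{⟨s,Ω_i⟩}`, the components of the derivative are the coordinates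
    -- of `u` in the basis `b`. Equality of dimensions then gives invertibility.
    have hinj : Function.Injective T := by
      rw [injective_iff_map_eq_zero]
      intro v hv
      obtain ⟨u, rfl⟩ := exists_mulInvariantVectorField_eq x v
      have h1 := (hφd' x u).symm.trans hv
      have hu : (u : GroupLieAlgebra (𝓡 n) G) = 0 := by
        rw [hexp u]
        refine Finset.sum_eq_zero fun i _ => ?_
        change l i u • b i = 0
        have h2 : l i u = 0 := by
          rcases i with j | i | k
          · exact congrArg (fun z : Space q p × EuclideanSpace ℝ (Fin r) => z.1.1 j) h1
          · have h3 : Real.exp (CyclicModel.weight Ω (s x) i) * l (.inr (.inl i)) u = 0 :=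
              congrArg (fun z : Space q p × EuclideanSpace ℝ (Fin r) => z.1.2 i) h1
            exact (mul_eq_zero.1 h3).resolve_left (Real.exp_pos _).ne'
          · exact congrArg (fun z : Space q p × EuclideanSpace ℝ (Fin r) => z.2 k) h1
        rw [h2, zero_smul]
      rw [hu, mulInvariantVectorField]
      exact map_zero (mfderiv (𝓡 n) (𝓡 n) (fun y : G => x * y) 1)
    have hfr : Module.finrank ℝ (EuclideanSpace ℝ (Fin n)) =
        Module.finrank ℝ (Space q p × EuclideanSpace ℝ (Fin r)) := by
      simp [Module.finrank_prod]
      omega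
    exact ⟨(LinearEquiv.ofInjectiveOfFinrankEq T.toLinearMap hinj hfr).toContinuousLinearEquiv,
      ContinuousLinearMap.ext fun v => rfl⟩
  let φ : G →* CyclicModel Ω × EuclideanGroup r := MonoidHom.mk' φ₀ fun g x => by
    refine Prod.ext (Prod.ext (hsm g x) (htm g x)) (hcm g x)
  have hφ1 : φ₀ 1 = (1 : CyclicModel Ω × EuclideanGroup r) := map_one φ
  obtain ⟨hmap, U, hU, hUinj⟩ := map_nhds_eq_of_isInvertible_mfderiv (hφ₀ 1) (hinv 1)
  have hmap' : Filter.map φ (𝓝 1) = 𝓝 1 := by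
    rw [hφ1] at hmap; exact hmap
  have hφcont : Continuous φ := hφ₀.continuous
  obtain ⟨hbij, hopen⟩ := bijective_of_map_nhds_one
    (M := CyclicModel Ω × EuclideanGroup r) φ hφcont hmap'
    ⟨U, hU, fun x hx hx1 => hUinj hx (mem_of_mem_nhds hU) (hx1.trans (map_one φ).symm)⟩
  let ψ : G ≃ₜ Space q p × EuclideanSpace ℝ (Fin r) :=
    (Equiv.ofBijective φ₀ hbij).toHomeomorphOfContinuousOpen hφ₀.continuous hopen
  have hψ := contMDiff_symm_of_isInvertible_mfderiv ψ hφ₀ hinv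
  have hst' : ContMDiff (𝓡 n) 𝓘(ℝ, Space q p) ∞ (fun x => (id (s x, t x) : CyclicModel Ω)) := hst
  have hcs' : ContMDiff (𝓡 n) (𝓡 r) ∞ (fun x => (id (c x) : EuclideanGroup r)) := hcs
  refine ⟨MulEquiv.ofBijective φ hbij, ?_, ?_, ?_⟩
  · have hprod := hst'.prodMk hcs'
    exact hprod
  · rw [modelWithCornersSelf_prod, ← chartedSpaceSelf_prod] at hψ
    have e : ∀ y, (MulEquiv.ofBijective φ hbij).symm y = ψ.symm y := fun y => by
      refine hbij.1 ?_
      exact ((MulEquiv.ofBijective φ hbij).apply_symm_apply y).trans (ψ.apply_symm_apply y).symm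
    exact ContMDiff.congr hψ e
  · intro x v w
    obtain ⟨u, rfl⟩ := exists_mulInvariantVectorField_eq x v
    obtain ⟨u', rfl⟩ := exists_mulInvariantVectorField_eq x w
    rw [inner_mulInvariantVectorField hi]
    have hm := mfderiv_prodMk (hst'.mdifferentiableAt (x := x) (by simp))
      (hcs'.mdifferentiableAt (x := x) (by simp))
    have hpm : ∀ A : EuclideanSpace ℝ (Fin n) →L[ℝ] Space q p × EuclideanSpace ℝ (Fin r),
        (mfderiv (𝓡 n) (𝓘(ℝ, Space q p).prod (𝓡 r)) (MulEquiv.ofBijective φ hbij) x :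
          EuclideanSpace ℝ (Fin n) →L[ℝ] Space q p × EuclideanSpace ℝ (Fin r)) = A →
        ∀ a a' : EuclideanSpace ℝ (Fin n), prodForm (CyclicModel.h0Form Ω (s x, t x)) (innerSL ℝ) (A a) (A a') =
          h.inner 1 u u' → prodForm (CyclicModel.h0Form Ω (s x, t x)) (innerSL ℝ)
          ((mfderiv (𝓡 n) (𝓘(ℝ, Space q p).prod (𝓡 r)) (MulEquiv.ofBijective φ hbij) x :
          EuclideanSpace ℝ (Fin n) →L[ℝ] Space q p × EuclideanSpace ℝ (Fin r)) a)
          ((mfderiv (𝓡 n) (𝓘(ℝ, Space q p).prod (𝓡 r)) (MulEquiv.ofBijective φ hbij) x :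
          EuclideanSpace ℝ (Fin n) →L[ℝ] Space q p × EuclideanSpace ℝ (Fin r)) a') = h.inner 1 u u' := by
      rintro A rfl a a' hA
      exact hA
    refine hpm _ hm _ _ ?_
    have hst₂ : ∀ u : EuclideanSpace ℝ (Fin n), invDeriv (fun x => ((s x, t x) : Space q p)) x u =
        (WithLp.toLp 2 fun j => l (.inl j) u, WithLp.toLp 2 fun i =>
          Real.exp (CyclicModel.weight Ω (s x) i) * l (.inr (.inl i)) u) := fun u => by
      rw [hstd, hsd, htd]
    have hF : ∀ (a a' A A' : Space q p) (z z' Z Z' : EuclideanSpace ℝ (Fin r)),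
        a = A → a' = A' → z = Z → z' = Z' →
        prodForm (CyclicModel.h0Form Ω (s x, t x)) (innerSL ℝ) (a, z) (a', z') =
          (∑ j, A.1 j * A'.1 j + ∑ i, Real.exp (-2 * CyclicModel.weight Ω (s x) i) *
            (A.2 i * A'.2 i)) + ∑ k, Z k * Z' k := by
      rintro a a' _ _ z z' _ _ rfl rfl rfl rfl
      refine congrArg₂ (· + ·) (CyclicModel.h0Form_apply Ω _ a a') ?_
      refine (PiLp.inner_apply z z').trans ?_
      exact Finset.sum_congr rfl fun k _ => mul_comm _ _
    refine (hF _ _ _ _ _ _ _ _ (hst₂ u) (hst₂ u') (hcd x u) (hcd x u')).trans ?_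
    have h1 : algebraForm h u u' = ∑ i, l i u * l i u' := by
      conv_lhs => rw [hexp u]
      simp only [map_sum, map_smul, LinearMap.sum_apply, LinearMap.smul_apply, smul_eq_mul]
      rfl
    refine Eq.trans ?_ h1.symm
    rw [Fintype.sum_sum_type, Fintype.sum_sum_type, ← add_assoc]
    refine congrArg₂ (· + ·) (congrArg₂ (· + ·) rfl (Finset.sum_congr rfl fun i _ => ?_)) rfl
    -- The factor `e^{-2⟨s,Ω_i⟩}` in the metric cancels the two factors `e^{⟨s,Ω_i⟩}` in the
    -- derivatives of `t_i`.
    have h2 : Real.exp (-2 * CyclicModel.weight Ω (s x) i) *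
        (Real.exp (CyclicModel.weight Ω (s x) i) * Real.exp (CyclicModel.weight Ω (s x) i)) = 1 := by
      rw [← Real.exp_add, ← Real.exp_add]
      ring_nf
      exact Real.exp_zero
    linear_combination (l (.inr (.inl i)) u * l (.inr (.inl i)) u') * h2

end Metric

end CyclicLie

theorem mainTheorem3 (n : ℕ) {G : Type*} [TopologicalSpace G]
    [ChartedSpace (EuclideanSpace ℝ (Fin n)) G] [Group G] [LieGroup (𝓡 n) ∞ G]
    [ConnectedSpace G] [SimplyConnectedSpace G]
    (h : CyclicLie.RiemannianMetricOn (𝓡 n) G)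
    (h_inv : CyclicLie.IsLeftInvariantMetric h) (h_cyclic : CyclicLie.IsCyclicMetric h)
    (h_solvable : LieAlgebra.IsSolvable (GroupLieAlgebra (𝓡 n) G))
    (h_nonabelian : ¬ ∀ a b : G, a * b = b * a) :
    (∃ (q p r : ℕ) (Ω : Matrix (Fin q) (Fin p) ℝ),
      0 < q ∧ 0 < p ∧ Ω.transpose.rank = q ∧ p + q + r = n ∧
      ∃ φ : G ≃* CyclicLie.CyclicModel Ω × CyclicLie.EuclideanGroup r,
        ContMDiff (𝓡 n) (𝓘(ℝ, CyclicLie.Space q p).prod (𝓡 r)) ∞ φ ∧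
        ContMDiff (𝓘(ℝ, CyclicLie.Space q p).prod (𝓡 r)) (𝓡 n) ∞ φ.symm ∧
        CyclicLie.PreservesMetric h
          (CyclicLie.prodMetric (CyclicLie.CyclicModel.h0 Ω)
            (CyclicLie.EuclideanGroup.flatMetric r)) φ) ∧
    IsLieAbelian (CyclicLie.derivedAlgebra (𝓡 n) G) ∧
    (∀ u ∈ CyclicLie.derivedOrthogonal h, ∀ x y : GroupLieAlgebra (𝓡 n) G,
      h.inner 1 ⁅u, x⁆ y = h.inner 1 x ⁅u, y⁆) ∧
    (∀ u ∈ CyclicLie.derivedOrthogonal h, ∀ v ∈ CyclicLie.derivedOrthogonal h,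
      ∀ x : GroupLieAlgebra (𝓡 n) G, ⁅u, ⁅v, x⁆⁆ = ⁅v, ⁅u, x⁆⁆) ∧
    (∃ b : Module.Basis (Fin n) ℝ (GroupLieAlgebra (𝓡 n) G),
      (∀ i j, h.inner 1 (b i) (b j) = if i = j then 1 else 0) ∧
      ∀ u ∈ CyclicLie.derivedOrthogonal h, ∀ i, ∃ c : ℝ, ⁅u, b i⁆ = c • b i) := by
  have hB : CyclicLie.IsCyclicForm (CyclicLie.algebraForm h) := h_cyclic
  have hs : ∀ x y, CyclicLie.algebraForm h x y = CyclicLie.algebraForm h y x := fun x y => h.symm 1 x y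
  have hp : ∀ x, x ≠ 0 → 0 < CyclicLie.algebraForm h x x := fun x hx => h.pos 1 x hx
  have hD : IsLieAbelian (CyclicLie.derivedAlgebra (𝓡 n) G) := hB.isLieAbelian_derived hs hp h_solvable
  have : FiniteDimensional ℝ (GroupLieAlgebra (𝓡 n) G) :=
    inferInstanceAs (FiniteDimensional ℝ (EuclideanSpace ℝ (Fin n)))
  obtain ⟨q, p, r, Ω, b, hrank, hb, ha, hc, he, heig⟩ := hB.exists_adapted_basis hs hp hD
  have hcard : q + (p + r) = n := by
    have h1 := Module.finrank_eq_card_basis b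
    have h2 : Module.finrank ℝ (GroupLieAlgebra (𝓡 n) G) = n :=
      finrank_euclideanSpace_fin (𝕜 := ℝ) (n := n)
    rw [h2] at h1
    simpa using h1.symm
  obtain ⟨φ, hφ⟩ := CyclicLie.exists_isometry_model h h_inv Ω b hb ha hc he
  -- Otherwise the model would be commutative, and so would `G`.
  have hqp : ¬ (q = 0 ∨ p = 0) := fun h0 => h_nonabelian fun x y => φ.injective (by
    rw [map_mul, map_mul]
    exact Prod.ext (CyclicLie.CyclicModel.mul_comm_of_eq_zero Ω h0 _ _) (mul_comm _ _))
  rw [not_or] at hqp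
  refine ⟨⟨q, p, r, Ω, Nat.pos_of_ne_zero hqp.1, Nat.pos_of_ne_zero hqp.2, hrank, by omega, φ, hφ⟩, hD,
    fun u hu x y => hB.ad_symm hs (hu _ (CyclicLie.lie_mem_derivedSeries_one x y)),
    fun u hu v hv x => ?_, ?_⟩
  · rw [leibniz_lie, hB.lie_eq_zero_of_orthogonal hs hp hD hu hv, zero_lie, zero_add]
  · let σ : Fin q ⊕ Fin p ⊕ Fin r ≃ Fin n := Fintype.equivFinOfCardEq (by simpa using hcard)
    refine ⟨b.reindex σ, fun i j => ?_, fun u hu i => ?_⟩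
    · rw [b.reindex_apply, b.reindex_apply, ← CyclicLie.algebraForm_apply, hb]
      simp
    · rw [b.reindex_apply]
      exact heig u hu _
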